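/- Let $N\in\mathbb N$, and let $g:\mathbb R^N\to\mathcal S^N$ take values in the positive definite symmetric $N\times N$ matrices. For $x,y\in\mathbb R^N$ put $$d_g(x,y)=\inf\Big\{\int_0^1\tfrac12\,\big(g(\gamma_t)\dot\gamma_t,\dot\gamma_t\big)^{1/2}dt:\ \gamma\in C^1([0,1];\mathbb R^N),\ \gamma_0=x,\ \gamma_1=y\Big\},\qquad e_g(x,y)=d_g(x,y)^2 .$$ Assume that $g$ and $g^{-1}$ belong to $C^2_b(\mathbb R^N;\mathcal S^N)$, i.e. they are of class $C^2$ and bounded together with their first and second derivatives. Then there exists $\Upsilon>0$ such that, on the open set $\{(x,y)\in\mathbb R^N\times\mathbb R^N:\ d_g(x,y)<\Upsilon\}$, the function $e_g$ is twice continuously differentiable and its full Hessian $D^2e_g$ (in the variables $(x,y)$) is bounded. Moreover $\Upsilon$ and the bound depend only on the $C^2$-bounds of $g$ and $g^{-1}$ (and on $N$): for every $N$ and every $M$ there are $\Upsilon>0$ and $K$ such that, whenever $g$ is as above and all entries of $g$ and $g^{-1}$ and their derivatives of order at most $2$ are bounded by $M$, one has $e_g\in C^2(\{d_g<\Upsilon\})$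 and $\|D^2e_g\|\le K$ on $\{d_g<\Upsilon\}$. -/

import Mathlib

noncomputable section

/-- The matrix field `f` on `ℝ^N` is of class `C²`, and its entries are bounded by `M` together
with their derivatives of first and second order; `f ∈ C²_b` means that this holds for some `M`. -/
def C2BoundedBy {N : ℕ} (M : ℝ)
    (f : EuclideanSpace ℝ (Fin N) → Matrix (Fin N) (Fin N) ℝ) : Prop :=
  ∀ i j : Fin N, ContDiff ℝ 2 (fun x => f x i j) ∧
    ∀ k : ℕ, k ≤ 2 → ∀ x, ‖iteratedFDeriv ℝ k (fun x => f x i j) x‖ ≤ M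

/-- The velocity of a curve on `[0,1]` (one-sided at the end points). -/
def curveVelocity {N : ℕ} (γ : ℝ → EuclideanSpace ℝ (Fin N)) (t : ℝ) :
    EuclideanSpace ℝ (Fin N) :=
  derivWithin γ (Set.Icc 0 1) t

/-- `∫₀¹ ½ (g(γ_t) γ̇_t, γ̇_t)^{1/2} dt`. -/
def halfLength {N : ℕ} (g : EuclideanSpace ℝ (Fin N) → Matrix (Fin N) (Fin N) ℝ)
    (γ : ℝ → EuclideanSpace ℝ (Fin N)) : ℝ :=
  ∫ t in (0 : ℝ)..1, (1 / 2 : ℝ) *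
    Real.sqrt (∑ i, ∑ j, g (γ t) i j * curveVelocity γ t i * curveVelocity γ t j)

/-- The distance `d_g`: the infimum of `halfLength` over the `C¹` curves on `[0,1]` that lead
from `x` to `y`. -/
def metricDist {N : ℕ} (g : EuclideanSpace ℝ (Fin N) → Matrix (Fin N) (Fin N) ℝ)
    (x y : EuclideanSpace ℝ (Fin N)) : ℝ :=
  sInf {ℓ : ℝ | ∃ γ : ℝ → EuclideanSpace ℝ (Fin N),
    ContDiffOn ℝ 1 γ (Set.Icc 0 1) ∧ γ 0 = x ∧ γ 1 = y ∧ ℓ = halfLength g γ}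

/-- The energy `e_g = d_g²`, as a function on `ℝ^N × ℝ^N`. -/
def metricEnergy {N : ℕ} (g : EuclideanSpace ℝ (Fin N) → Matrix (Fin N) (Fin N) ℝ)
    (z : EuclideanSpace ℝ (Fin N) × EuclideanSpace ℝ (Fin N)) : ℝ :=
  metricDist g z.1 z.2 ^ 2

end

/-!
Two points `x`, `y` at small distance are joined by a geodesic `γ` whose velocity depends on
`(x, y)` in a `C¹` way, and the differential of the energy `e = ¼ ∫ g(γ) γ' γ'` is read off from the
velocities at the two ends; so `e` is one degree smoother than the velocity. It remains to identify
`e` with the squared distance.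

*Geodesics.* With `S` the field of Christoffel symbols (up to sign), the geodesic equation
`γ'' = S γ γ' γ'` with `γ 0 = x`, `γ 1 = y` is a fixed point equation for the velocity `v = γ'` in
the Banach space `C([0, 1], E)`: `v = (y - x) + T (S γ v v)`, where `γ t = x + ∫₀ᵗ v` and `T` takes
the primitive of mean zero. As `S` is bounded and Lipschitz and the nonlinearity is quadratic in
`v`, this is a contraction on a small ball, with constants depending only on the bounds for `S`.
Since `S` is `C¹`, so is the fixed point map (`contDiff_superposition`), and the implicit function
theorem makes the solution `C¹` in `(x, y)`; its Lipschitz constant is explicit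
(`exists_geodesic_velocity`). No inversion of an exponential map is needed.

*Energy.* The first variation formula (`IsMetricField.integral_first_variation`) gives
`De (x, y) (a, b) = ½ (g y (v 1) b - g x (v 0) a)`. The right-hand side is `C¹` in `(x, y)` with
explicit Lipschitz constant, so `e` is `C²` with bounded Hessian (`IsMetricField.exists_energy`).

*Distance.* Geodesics have constant speed, so the half-length of `γ` is `√e`, whence `d ≤ √e`.
Conversely, by the formula for `De`, the differential of `y ↦ √(e (x, y))` is at most half the
metric norm: integrating it along any `C¹` curve that stays near `x` bounds the half-length of the
curve from below by `√e` (`IsMetricField.sqrt_energy_le_riemannHalfLength`). A curve that does not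
stay near `x` is longer than a fixed constant by ellipticity. Hence `d² = e` on `{d < Υ}`.
-/

set_option maxSynthPendingDepth 3

open Set Filter Topology

/-! ### Superposition operators on spaces of continuous functions -/

section Superposition

variable {K E F : Type*} [TopologicalSpace K] [CompactSpace K]
  [NormedAddCommGroup E] [NormedSpace ℝ E] [NormedAddCommGroup F] [NormedSpace ℝ F]

/-- The multiplication operator `h ↦ (t ↦ A t (h t))` attached to a continuous family `A` of
continuous linear maps, depending linearly and continuously on `A`. -/
noncomputable def pointwiseApply : C(K, E →L[ℝ] F) →L[ℝ] C(K, E) →L[ℝ] C(K, F) :=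
  LinearMap.mkContinuous₂
    (LinearMap.mk₂ ℝ (fun (A : C(K, E →L[ℝ] F)) (h : C(K, E)) =>
        (⟨fun t => A t (h t), by fun_prop⟩ : C(K, F)))
      (fun _ _ _ => by ext; simp) (fun _ _ _ => by ext; simp)
      (fun _ _ _ => by ext; simp) (fun _ _ _ => by ext; simp)) 1
    (fun A h => by
      refine (ContinuousMap.norm_le _ (by positivity)).2 fun t => ?_
      simpa using (A t).le_of_opNorm_le_of_le (A.norm_coe_le_norm t) (h.norm_coe_le_norm t))

@[simp]
theorem pointwiseApply_apply (A : C(K, E →L[ℝ] F)) (h : C(K, E)) (t : K) :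
    pointwiseApply A h t = A t (h t) := rfl

/-- The superposition operator of a `C¹` map is differentiable: the remainder at `h` is controlled
by the oscillation of `fderiv f` along the segments from `u t` to `u t + h t`, which is small
uniformly in `t` because composition with `fderiv f` is continuous for the compact-open
topology. -/
theorem hasFDerivAt_superposition {f : E → F} (hf : ContDiff ℝ 1 f) (u : C(K, E)) :
    HasFDerivAt (fun u : C(K, E) => (⟨f, hf.continuous⟩ : C(E, F)).comp u)
      (pointwiseApply
        ((⟨fderiv ℝ f, hf.continuous_fderiv one_ne_zero⟩ : C(E, E →L[ℝ] F)).comp u)) u := by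
  set f' : C(E, E →L[ℝ] F) := ⟨fderiv ℝ f, hf.continuous_fderiv one_ne_zero⟩
  rw [hasFDerivAt_iff_isLittleO_nhds_zero, Asymptotics.isLittleO_iff]
  intro ε hε
  have hcont : Continuous fun k : C(K, E) => f'.comp k := f'.continuous_postcomp
  obtain ⟨δ, hδ, hball⟩ :=
    Metric.continuous_iff (α := C(K, E)) (β := C(K, E →L[ℝ] F)) |>.1 hcont u ε hε
  filter_upwards [Metric.ball_mem_nhds (0 : C(K, E)) hδ] with h hh
  rw [mem_ball_zero_iff] at hh
  refine (ContinuousMap.norm_le _ (by positivity)).2 fun t => ?_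
  have hseg : ∀ z ∈ segment ℝ (u t) (u t + h t),
      ‖fderiv ℝ f z - fderiv ℝ f (u t)‖ ≤ ε := by
    intro z hz
    rw [segment_eq_image'] at hz
    obtain ⟨s, hs, rfl⟩ := hz
    have hk : dist (u + s • h) u < δ := by
      rw [dist_eq_norm, add_sub_cancel_left, norm_smul, Real.norm_of_nonneg hs.1]
      nlinarith [hs.2, hs.1, norm_nonneg h]
    have := (ContinuousMap.dist_apply_le_dist t).trans (hball _ hk).le
    simpa [dist_eq_norm, f'] using this
  have hmv := (convex_segment (u t) (u t + h t)).norm_image_sub_le_of_norm_hasFDerivWithin_le'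
    (fun z _ => ((hf.differentiable one_ne_zero z).hasFDerivAt).hasFDerivWithinAt) hseg
    (left_mem_segment ℝ _ _) (right_mem_segment ℝ _ _)
  calc _ = ‖f (u t + h t) - f (u t) - fderiv ℝ f (u t) (u t + h t - u t)‖ := by simp [f']
    _ ≤ ε * ‖u t + h t - u t‖ := hmv
    _ ≤ ε * ‖h‖ := by
      rw [add_sub_cancel_left]
      gcongr
      exact h.norm_coe_le_norm t

theorem contDiff_superposition {f : E → F} (hf : ContDiff ℝ 1 f) :
    ContDiff ℝ 1 (fun u : C(K, E) => (⟨f, hf.continuous⟩ : C(E, F)).comp u) := by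
  rw [contDiff_one_iff_fderiv]
  refine ⟨fun u => (hasFDerivAt_superposition hf u).differentiableAt, ?_⟩
  rw [funext fun u : C(K, E) => (hasFDerivAt_superposition hf u).fderiv]
  exact pointwiseApply.continuous.comp (ContinuousMap.continuous_postcomp _)

end Superposition

/-! ### Integration operators on paths over the unit interval -/

section Paths

variable {E : Type*} [NormedAddCommGroup E]

/-- The extension of a path on the unit interval to the real line, constant outside `[0, 1]`. -/
noncomputable def pathExtend (v : C(Icc (0 : ℝ) 1, E)) : ℝ → E := IccExtend zero_le_one v

theorem continuous_pathExtend (v : C(Icc (0 : ℝ) 1, E)) : Continuous (pathExtend v) :=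
  v.continuous.Icc_extend'

theorem pathExtend_apply (v : C(Icc (0 : ℝ) 1, E)) (t : Icc (0 : ℝ) 1) :
    pathExtend v t = v t := IccExtend_val _ _ _

theorem pathExtend_of_mem (v : C(Icc (0 : ℝ) 1, E)) {t : ℝ} (ht : t ∈ Icc (0 : ℝ) 1) :
    pathExtend v t = v ⟨t, ht⟩ := IccExtend_of_mem _ _ ht

theorem pathExtend_zero (v : C(Icc (0 : ℝ) 1, E)) : pathExtend v 0 = v 0 := pathExtend_apply v 0

theorem pathExtend_one (v : C(Icc (0 : ℝ) 1, E)) : pathExtend v 1 = v 1 := pathExtend_apply v 1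

theorem norm_pathExtend_le (v : C(Icc (0 : ℝ) 1, E)) (t : ℝ) : ‖pathExtend v t‖ ≤ ‖v‖ :=
  v.norm_coe_le_norm _

variable [NormedSpace ℝ E]

/-- The primitive `t ↦ ∫₀ᵗ v` on the whole real line. -/
noncomputable def pathIntegral (v : C(Icc (0 : ℝ) 1, E)) (t : ℝ) : E :=
  ∫ s in (0 : ℝ)..t, pathExtend v s

theorem pathIntegral_zero (v : C(Icc (0 : ℝ) 1, E)) : pathIntegral v 0 = 0 := by
  simp [pathIntegral]

theorem norm_pathIntegral_le (v : C(Icc (0 : ℝ) 1, E)) {t : ℝ} (ht : t ∈ Icc (0 : ℝ) 1) :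
    ‖pathIntegral v t‖ ≤ ‖v‖ := by
  have := intervalIntegral.norm_integral_le_of_norm_le_const (a := 0) (b := t)
    (f := pathExtend v) fun s _ => norm_pathExtend_le v s
  refine this.trans ?_
  rw [sub_zero, abs_of_nonneg ht.1]
  exact mul_le_of_le_one_right (norm_nonneg _) ht.2

variable [CompleteSpace E]

theorem hasDerivAt_pathIntegral (v : C(Icc (0 : ℝ) 1, E)) (t : ℝ) :
    HasDerivAt (pathIntegral v) (pathExtend v t) t :=
  (continuous_pathExtend v).integral_hasStrictDerivAt 0 t |>.hasDerivAt

theorem continuous_pathIntegral (v : C(Icc (0 : ℝ) 1, E)) : Continuous (pathIntegral v) :=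
  continuous_iff_continuousAt.2 fun t => (hasDerivAt_pathIntegral v t).continuousAt

/-- The operator `v ↦ (t ↦ ∫₀ᵗ v)` on paths over the unit interval. -/
noncomputable def primitive : C(Icc (0 : ℝ) 1, E) →L[ℝ] C(Icc (0 : ℝ) 1, E) :=
  LinearMap.mkContinuous
    { toFun := fun v => ⟨fun t => pathIntegral v t,
        (continuous_pathIntegral v).comp continuous_subtype_val⟩
      map_add' := fun u v => by
        ext t
        exact intervalIntegral.integral_add ((continuous_pathExtend u).intervalIntegrable _ _)
          ((continuous_pathExtend v).intervalIntegrable _ _)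
      map_smul' := fun c v => by
        ext t
        exact intervalIntegral.integral_smul c _ } 1
    (fun v => by
      refine (ContinuousMap.norm_le _ (by positivity)).2 fun t => ?_
      simpa using norm_pathIntegral_le v t.2)

theorem primitive_apply (v : C(Icc (0 : ℝ) 1, E)) (t : Icc (0 : ℝ) 1) :
    primitive v t = pathIntegral v t := rfl

theorem norm_primitive_le (v : C(Icc (0 : ℝ) 1, E)) : ‖primitive v‖ ≤ ‖v‖ :=
  (ContinuousMap.norm_le _ (norm_nonneg _)).2 fun t => norm_pathIntegral_le v t.2

/-- The primitive of mean zero of a path. -/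
noncomputable def centeredPrimitive : C(Icc (0 : ℝ) 1, E) →L[ℝ] C(Icc (0 : ℝ) 1, E) :=
  primitive - (ContinuousLinearMap.const ℝ (Icc (0 : ℝ) 1)) ∘L (ContinuousMap.evalCLM ℝ 1) ∘L
    primitive ∘L primitive

theorem centeredPrimitive_apply (q : C(Icc (0 : ℝ) 1, E)) (t : Icc (0 : ℝ) 1) :
    centeredPrimitive q t = pathIntegral q t - primitive (primitive q) 1 := rfl

theorem norm_centeredPrimitive_le (q : C(Icc (0 : ℝ) 1, E)) :
    ‖centeredPrimitive q‖ ≤ 2 * ‖q‖ := by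
  refine (ContinuousMap.norm_le _ (by positivity)).2 fun t => ?_
  rw [centeredPrimitive_apply, two_mul]
  refine (norm_sub_le _ _).trans (add_le_add (norm_pathIntegral_le q t.2) ?_)
  exact ((primitive (primitive q)).norm_coe_le_norm 1).trans
    ((norm_primitive_le _).trans (norm_primitive_le _))

theorem primitive_const_one (c : E) :
    primitive (ContinuousLinearMap.const ℝ (Icc (0 : ℝ) 1) c) 1 = c := by
  have : pathExtend (ContinuousLinearMap.const ℝ (Icc (0 : ℝ) 1) c) = fun _ => c := rfl
  simp [primitive_apply, pathIntegral, this]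

theorem primitive_centeredPrimitive_one (q : C(Icc (0 : ℝ) 1, E)) :
    primitive (centeredPrimitive q) 1 = 0 := by
  have : centeredPrimitive q =
    primitive q - ContinuousLinearMap.const ℝ (Icc (0 : ℝ) 1) (primitive (primitive q) 1) := rfl
  rw [this, map_sub, ContinuousMap.sub_apply, primitive_const_one, sub_self]

/-- The phase-space path `t ↦ (x + ∫₀ᵗ v, v t)` of the curve issued from `x` with velocity `v`. -/
noncomputable def phasePath : E × C(Icc (0 : ℝ) 1, E) →L[ℝ] C(Icc (0 : ℝ) 1, E × E) :=
  (ContinuousLinearMap.inl ℝ E E).compLeftContinuous ℝ _ ∘L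
      ((ContinuousLinearMap.const ℝ _).coprod primitive) +
    (ContinuousLinearMap.inr ℝ E E).compLeftContinuous ℝ _ ∘L ContinuousLinearMap.snd ℝ _ _

theorem phasePath_apply (x : E) (v : C(Icc (0 : ℝ) 1, E)) (t : Icc (0 : ℝ) 1) :
    phasePath (x, v) t = (x + pathIntegral v t, v t) := by
  simp [phasePath, primitive_apply]

/-- Integration over the unit interval, as a continuous linear functional on paths. -/
noncomputable def integralCLM : C(Icc (0 : ℝ) 1, E) →L[ℝ] E :=
  (ContinuousMap.evalCLM ℝ 1) ∘L primitive

theorem integralCLM_apply (v : C(Icc (0 : ℝ) 1, E)) :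
    integralCLM v = ∫ s in (0 : ℝ)..1, pathExtend v s := rfl

end Paths

/-! ### Fixed points of contractions depending on a parameter -/

section FixedPoint

variable {P V : Type*} [NormedAddCommGroup P] [NormedSpace ℝ P] [CompleteSpace P]
  [NormedAddCommGroup V] [NormedSpace ℝ V] [CompleteSpace V]

/-- A `C¹` fixed point equation `v = Φ (p, v)`, contracting in `v` and Lipschitz in `p`, has a
solution that is `C¹` and Lipschitz in `p`. The regularity comes from the implicit function
theorem, whose local solution is the fixed point by uniqueness. -/
theorem exists_contDiffOn_fixedPoint {Φ : P × V → V} (hΦ : ContDiff ℝ 1 Φ) {U : Set P}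
    (hU : IsOpen U) {ρ L : ℝ} (hρ : 0 < ρ)
    (hself : ∀ p ∈ U, ∀ v, ‖v‖ ≤ ρ → ‖Φ (p, v)‖ < ρ)
    (hlip : ∀ p ∈ U, ∀ v, ‖v‖ ≤ ρ → ∀ v', ‖v'‖ ≤ ρ →
      ‖Φ (p, v) - Φ (p, v')‖ ≤ 1 / 2 * ‖v - v'‖)
    (hpar : ∀ p ∈ U, ∀ p' ∈ U, ∀ v, ‖v‖ ≤ ρ → ‖Φ (p, v) - Φ (p', v)‖ ≤ L * ‖p - p'‖) :
    ∃ S : P → V, (∀ p ∈ U, ‖S p‖ < ρ ∧ S p = Φ (p, S p)) ∧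
      (∀ p ∈ U, ∀ p' ∈ U, ‖S p - S p'‖ ≤ 2 * L * ‖p - p'‖) ∧ ContDiffOn ℝ 1 S U := by
  have hex : ∀ p ∈ U, ∃ v, ‖v‖ < ρ ∧ v = Φ (p, v) := by
    intro p hp
    have hmaps : MapsTo (fun v => Φ (p, v)) (Metric.closedBall 0 ρ) (Metric.closedBall 0 ρ) := by
      intro v hv
      rw [mem_closedBall_zero_iff] at hv ⊢
      exact (hself p hp v hv).le
    have hcontr : ContractingWith (1 / 2) (hmaps.restrict _ _ _) := by
      refine ⟨by norm_num, LipschitzWith.of_dist_le_mul fun v w => ?_⟩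
      have := hlip p hp v (mem_closedBall_zero_iff.1 v.2) w (mem_closedBall_zero_iff.1 w.2)
      simpa [Subtype.dist_eq, dist_eq_norm] using this
    obtain ⟨v, hv, hfix, -⟩ := hcontr.exists_fixedPoint' Metric.isClosed_closedBall.isComplete
      hmaps (Metric.mem_closedBall_self hρ.le) (edist_ne_top _ _)
    have hfix' : Φ (p, v) = v := hfix
    exact ⟨v, hfix' ▸ hself p hp v (mem_closedBall_zero_iff.1 hv), hfix'.symm⟩
  choose! S hS using hex
  have hSlip : ∀ p ∈ U, ∀ p' ∈ U, ‖S p - S p'‖ ≤ 2 * L * ‖p - p'‖ := by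
    intro p hp p' hp'
    have h1 := hlip p hp _ (hS p hp).1.le _ (hS p' hp').1.le
    have h2 := hpar p hp p' hp' _ (hS p' hp').1.le
    have h3 : ‖S p - S p'‖ ≤
        ‖Φ (p, S p) - Φ (p, S p')‖ + ‖Φ (p, S p') - Φ (p', S p')‖ := by
      calc ‖S p - S p'‖ = ‖Φ (p, S p) - Φ (p', S p')‖ := by
            rw [← (hS p hp).2, ← (hS p' hp').2]
        _ ≤ _ := norm_sub_le_norm_sub_add_norm_sub _ _ _
    linarith
  refine ⟨S, hS, hSlip, fun p hp => ContDiffAt.contDiffWithinAt ?_⟩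
  have hUp : U ∈ 𝓝 p := hU.mem_nhds hp
  have hScont : ContinuousAt S p := by
    have hlim : Tendsto (fun q => 2 * L * ‖q - p‖) (𝓝 p) (𝓝 0) := by
      have : Continuous fun q => 2 * L * ‖q - p‖ := by fun_prop
      simpa using this.tendsto p
    rw [ContinuousAt, tendsto_iff_norm_sub_tendsto_zero]
    refine squeeze_zero' (.of_forall fun _ => norm_nonneg _) ?_ hlim
    filter_upwards [hUp] with q hq using hSlip q hq p hp
  set f : P × V → V := fun z => z.2 - Φ z with hf
  have hfC : ContDiffAt ℝ 1 f (p, S p) := (contDiff_snd.sub hΦ).contDiffAt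
  have hΦd : DifferentiableAt ℝ Φ (p, S p) := hΦ.differentiable one_ne_zero _
  set B : V →L[ℝ] V := fderiv ℝ Φ (p, S p) ∘L .inr ℝ P V with hB
  -- The contraction property bounds the partial derivative of `Φ` by `1 / 2`.
  have hBnorm : ‖B‖ ≤ 1 / 2 := by
    have hBd : HasFDerivAt (fun v => Φ (p, v)) B (S p) :=
      hΦd.hasFDerivAt.comp (S p) (hasFDerivAt_prodMk_right p (S p))
    refine hBd.le_of_lip' (by norm_num) ?_
    have : Metric.ball (0 : V) ρ ∈ 𝓝 (S p) :=
      Metric.isOpen_ball.mem_nhds (mem_ball_zero_iff.2 (hS p hp).1)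
    filter_upwards [this] with v hv
    exact hlip p hp v (mem_ball_zero_iff.1 hv).le _ (hS p hp).1.le
  have hfinr : fderiv ℝ f (p, S p) ∘L .inr ℝ P V = 1 - B := by
    have : HasFDerivAt f (ContinuousLinearMap.snd ℝ P V - fderiv ℝ Φ (p, S p)) (p, S p) :=
      hasFDerivAt_snd.sub hΦd.hasFDerivAt
    rw [this.fderiv]
    ext v
    simp [hB]
  have hinv : (fderiv ℝ f (p, S p) ∘L .inr ℝ P V).IsInvertible := by
    rw [hfinr]
    obtain ⟨u, hu⟩ := isUnit_one_sub_of_norm_lt_one (x := B) (by linarith)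
    exact ⟨ContinuousLinearEquiv.unitsEquiv ℝ V u, by rw [← hu]; rfl⟩
  refine (hfC.contDiffAt_implicitFunction one_ne_zero hinv).congr_of_eventuallyEq ?_
  have hlim : Tendsto (fun q => (q, S q)) (𝓝 p) (𝓝 (p, S p)) :=
    continuousAt_id.prodMk hScont
  filter_upwards [hlim.eventually (hfC.eventually_apply_eq_iff_implicitFunction one_ne_zero hinv),
    hUp] with q hq hqU
  refine (hq.1 ?_).symm
  simp only [hf]
  rw [← (hS q hqU).2, ← (hS p hp).2, sub_self, sub_self]

end FixedPoint

/-! ### The two-point boundary value problem for short geodesics -/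

section BoundaryValue

variable {E : Type*} [NormedAddCommGroup E] [NormedSpace ℝ E]

/-- The curve issued from `x` with velocity `v`. -/
noncomputable def pathFrom (x : E) (v : C(Icc (0 : ℝ) 1, E)) (t : ℝ) : E := x + pathIntegral v t

theorem pathFrom_zero (x : E) (v : C(Icc (0 : ℝ) 1, E)) : pathFrom x v 0 = x := by
  simp [pathFrom, pathIntegral_zero]

theorem norm_quadratic_sub_le {S S' : E →L[ℝ] E →L[ℝ] E} {v v' : E} {C d ρ : ℝ} (hS : ‖S‖ ≤ C)
    (hSS' : ‖S - S'‖ ≤ C * d) (hv : ‖v‖ ≤ ρ) (hv' : ‖v'‖ ≤ ρ) (hS' : ‖S'‖ ≤ C) (hd : 0 ≤ d) :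
    ‖S v v - S' v' v'‖ ≤ C * d * ρ * ρ + 2 * (C * ρ * ‖v - v'‖) := by
  have hC : 0 ≤ C := (norm_nonneg S).trans hS
  have hρ : 0 ≤ ρ := (norm_nonneg _).trans hv
  have h : S v v - S' v' v' = (S - S') v v + (S' (v - v') v + S' v' (v - v')) := by
    simp only [sub_apply, map_sub]; abel
  rw [h]
  have h1 : ‖(S - S') v v‖ ≤ C * d * ρ * ρ := by
    refine ((S - S').le_opNorm₂ v v).trans ?_
    gcongr
  have h2 : ‖S' (v - v') v‖ ≤ C * ‖v - v'‖ * ρ := by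
    refine (S'.le_opNorm₂ _ _).trans ?_
    gcongr
  have h3 : ‖S' v' (v - v')‖ ≤ C * ρ * ‖v - v'‖ := by
    refine (S'.le_opNorm₂ _ _).trans ?_
    gcongr
  have := (norm_add_le ((S - S') v v) _).trans
    (add_le_add_right (norm_add_le (S' (v - v') v) (S' v' (v - v'))) _)
  linarith

variable [CompleteSpace E]

theorem hasDerivAt_pathFrom (x : E) (v : C(Icc (0 : ℝ) 1, E)) (t : ℝ) :
    HasDerivAt (pathFrom x v) (pathExtend v t) t :=
  (hasDerivAt_pathIntegral v t).const_add x

theorem contDiff_pathFrom (x : E) (v : C(Icc (0 : ℝ) 1, E)) :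
    ContDiff ℝ 1 (pathFrom x v) := by
  rw [contDiff_one_iff_deriv]
  refine ⟨fun t => (hasDerivAt_pathFrom x v t).differentiableAt, ?_⟩
  rw [funext fun t => (hasDerivAt_pathFrom x v t).deriv]
  exact continuous_pathExtend v

theorem continuous_pathFrom (x : E) (v : C(Icc (0 : ℝ) 1, E)) : Continuous (pathFrom x v) :=
  continuous_const.add (continuous_pathIntegral v)

theorem pathFrom_one (x : E) (v : C(Icc (0 : ℝ) 1, E)) : pathFrom x v 1 = x + primitive v 1 := rfl

/-- The acceleration `t ↦ S (γ t) (v t) (v t)`, as a function of the phase-space path `(γ, v)`. -/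
noncomputable def quadraticSpray (S : E → E →L[ℝ] E →L[ℝ] E) (hS : ContDiff ℝ 1 S) : C(E × E, E) :=
  ⟨fun z => S z.1 z.2 z.2, by have := hS.continuous; fun_prop⟩

/-- The fixed point map of the boundary value problem `γ'' = S γ γ' γ'`, `γ 0 = x`, `γ 1 = y`,
with the velocity `v = γ'` as unknown and `(x, y)` as parameter. Its fixed points satisfy
`∫ v = y - x` because `centeredPrimitive` takes values of mean zero. -/
noncomputable def geodesicMap (S : E → E →L[ℝ] E →L[ℝ] E) (hS : ContDiff ℝ 1 S)
    (p : (E × E) × C(Icc (0 : ℝ) 1, E)) : C(Icc (0 : ℝ) 1, E) :=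
  ContinuousLinearMap.const ℝ (Icc (0 : ℝ) 1) (p.1.2 - p.1.1) +
    centeredPrimitive ((quadraticSpray S hS).comp (phasePath (p.1.1, p.2)))

theorem contDiff_geodesicMap (S : E → E →L[ℝ] E →L[ℝ] E) (hS : ContDiff ℝ 1 S) :
    ContDiff ℝ 1 (geodesicMap S hS) := by
  have hq : ContDiff ℝ 1 fun z : E × E => S z.1 z.2 z.2 :=
    ((hS.comp contDiff_fst).clm_apply contDiff_snd).clm_apply contDiff_snd
  have hN : ContDiff ℝ 1 fun u : C(Icc (0 : ℝ) 1, E × E) => (quadraticSpray S hS).comp u :=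
    contDiff_superposition hq
  have hp : ContDiff ℝ 1 fun p : (E × E) × C(Icc (0 : ℝ) 1, E) => phasePath (p.1.1, p.2) :=
    (phasePath (E := E)).contDiff.comp
      (f := fun p : (E × E) × C(Icc (0 : ℝ) 1, E) => (p.1.1, p.2))
      ((contDiff_fst.comp contDiff_fst).prodMk contDiff_snd)
  have hc : ContDiff ℝ 1 fun w : E => ContinuousLinearMap.const ℝ (Icc (0 : ℝ) 1) w :=
    ContinuousLinearMap.contDiff (E := E) (F := C(Icc (0 : ℝ) 1, E)) _
  have hT : ContDiff ℝ 1 fun q : C(Icc (0 : ℝ) 1, E) => centeredPrimitive q :=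
    (centeredPrimitive (E := E)).contDiff
  exact (hc.comp ((contDiff_snd.comp contDiff_fst).sub (contDiff_fst.comp contDiff_fst))).add
    (hT.comp (hN.comp hp))

/-- For end points at distance less than `1 / (24 C)`, the equation `γ'' = S γ γ' γ'` has a
solution joining them whose velocity is a `C¹` and Lipschitz function of the end points. -/
theorem exists_geodesic_velocity {S : E → E →L[ℝ] E →L[ℝ] E} (hS : ContDiff ℝ 1 S) {C : ℝ}
    (hC : 1 ≤ C) (hbound : ∀ x, ‖S x‖ ≤ C) (hlip : ∀ x y, ‖S x - S y‖ ≤ C * ‖x - y‖) :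
    ∃ V : E × E → C(Icc (0 : ℝ) 1, E),
      (∀ z : E × E, ‖z.2 - z.1‖ < 1 / (24 * C) →
        ‖V z‖ ≤ 2 * ‖z.2 - z.1‖ ∧ primitive (V z) 1 = z.2 - z.1 ∧
        ∀ t ∈ Ioo (0 : ℝ) 1, HasDerivAt (pathExtend (V z))
          (S (pathFrom z.1 (V z) t) (pathExtend (V z) t) (pathExtend (V z) t)) t) ∧
      (∀ z z' : E × E, ‖z.2 - z.1‖ < 1 / (24 * C) → ‖z'.2 - z'.1‖ < 1 / (24 * C) →
        ‖V z - V z'‖ ≤ 6 * ‖z - z'‖) ∧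
      ContDiffOn ℝ 1 V {z | ‖z.2 - z.1‖ < 1 / (24 * C)} := by
  have hC0 : 0 < C := by linarith
  -- The nonlinear term has Lipschitz constant at most `C * ρ ^ 2 + 2 * C * ρ ≤ 1 / 4` on the ball
  -- of radius `ρ`, and `centeredPrimitive` at most doubles it.
  set ρ : ℝ := 1 / (12 * C) with hρdef
  have hρ : 0 < ρ := by positivity
  have hCρ : C * ρ = 1 / 12 := by rw [hρdef]; field_simp
  have hρ1 : ρ ≤ 1 / 12 := by nlinarith
  have hrρ : 1 / (24 * C) = ρ / 2 := by rw [hρdef]; field_simp; norm_num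
  -- The nonlinear term at two phase-space paths.
  have hspray : ∀ (x x' : E) (v v' : C(Icc (0 : ℝ) 1, E)), ‖v‖ ≤ ρ → ‖v'‖ ≤ ρ →
      ‖(quadraticSpray S hS).comp (phasePath (x, v)) -
        (quadraticSpray S hS).comp (phasePath (x', v'))‖ ≤
        C * (‖x - x'‖ + ‖v - v'‖) * ρ * ρ + 2 * (C * ρ * ‖v - v'‖) := by
    intro x x' v v' hv hv'
    refine (ContinuousMap.norm_le _ (by positivity)).2 fun t => ?_
    have hd : ‖(x + pathIntegral v t) - (x' + pathIntegral v' t)‖ ≤ ‖x - x'‖ + ‖v - v'‖ := by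
      rw [add_sub_add_comm]
      refine (norm_add_le _ _).trans (add_le_add_right ?_ _)
      have : pathIntegral v t - pathIntegral v' t = primitive (v - v') t := by
        rw [map_sub]; rfl
      rw [this]
      exact ((primitive (v - v')).norm_coe_le_norm t).trans (norm_primitive_le _)
    have hvt : ‖v t - v' t‖ ≤ ‖v - v'‖ := (v - v').norm_coe_le_norm t
    have := norm_quadratic_sub_le (hbound (x + pathIntegral v t))
      ((hlip _ (x' + pathIntegral v' t)).trans (mul_le_mul_of_nonneg_left hd hC0.le))
      ((v.norm_coe_le_norm t).trans hv) ((v'.norm_coe_le_norm t).trans hv') (hbound _)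
      (by positivity)
    have hval : ((quadraticSpray S hS).comp (phasePath (x, v)) -
        (quadraticSpray S hS).comp (phasePath (x', v'))) t =
        S (x + pathIntegral v t) (v t) (v t) - S (x' + pathIntegral v' t) (v' t) (v' t) := by
      simp [quadraticSpray, phasePath_apply]
    rw [hval]
    refine this.trans ?_
    gcongr
  have hzero : ∀ x : E, (quadraticSpray S hS).comp (phasePath (x, 0)) = 0 := by
    intro x; ext t; simp [quadraticSpray, phasePath_apply]
  obtain ⟨V, hV, hVlip, hVC⟩ := exists_contDiffOn_fixedPoint (contDiff_geodesicMap S hS)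
    (U := {z : E × E | ‖z.2 - z.1‖ < 1 / (24 * C)})
    (isOpen_lt (by fun_prop) continuous_const) (ρ := ρ) (L := 3) hρ
    (by
      intro p hp v hv
      have hp' : ‖p.2 - p.1‖ < ρ / 2 := hrρ ▸ hp
      have h1 := hspray p.1 p.1 v 0 hv (by simpa using hρ.le)
      rw [hzero, sub_zero, sub_self, norm_zero, zero_add, sub_zero] at h1
      have h2 := norm_centeredPrimitive_le ((quadraticSpray S hS).comp (phasePath (p.1, v)))
      have h3 : ‖ContinuousLinearMap.const ℝ (Icc (0 : ℝ) 1) (p.2 - p.1)‖ ≤ ‖p.2 - p.1‖ :=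
        (ContinuousMap.norm_le _ (norm_nonneg _)).2 fun t => le_rfl
      have h4 := norm_add_le (ContinuousLinearMap.const ℝ (Icc (0 : ℝ) 1) (p.2 - p.1))
        (centeredPrimitive ((quadraticSpray S hS).comp (phasePath (p.1, v))))
      have h5 : C * ‖v‖ * ρ * ρ = 1 / 12 * ρ * ‖v‖ := by rw [← hCρ]; ring
      rw [h5, hCρ] at h1
      have h6 : ρ * ‖v‖ ≤ 1 / 12 * ρ := by nlinarith
      have : ‖geodesicMap S hS (p, v)‖ ≤ _ := h4
      linarith)
    (by
      intro p hp v hv v' hv'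
      have h1 := hspray p.1 p.1 v v' hv hv'
      rw [sub_self, norm_zero, zero_add] at h1
      have h2 : geodesicMap S hS (p, v) - geodesicMap S hS (p, v') = centeredPrimitive
          ((quadraticSpray S hS).comp (phasePath (p.1, v)) -
            (quadraticSpray S hS).comp (phasePath (p.1, v'))) := by
        rw [map_sub, geodesicMap, geodesicMap, add_sub_add_left_eq_sub]
      rw [h2]
      refine (norm_centeredPrimitive_le _).trans ?_
      have h5 : C * ‖v - v'‖ * ρ * ρ = 1 / 12 * ρ * ‖v - v'‖ := by rw [← hCρ]; ring
      rw [h5, hCρ] at h1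
      have h6 : ρ * ‖v - v'‖ ≤ 1 / 12 * ‖v - v'‖ :=
        mul_le_mul_of_nonneg_right hρ1 (norm_nonneg _)
      linarith [norm_nonneg (v - v')])
    (by
      intro p hp p' hp' v hv
      have h1 := hspray p.1 p'.1 v v hv hv
      rw [sub_self, norm_zero, add_zero, mul_zero, mul_zero, add_zero] at h1
      have h2 : geodesicMap S hS (p, v) - geodesicMap S hS (p', v) =
          ContinuousLinearMap.const ℝ (Icc (0 : ℝ) 1) ((p.2 - p'.2) - (p.1 - p'.1)) +
          centeredPrimitive ((quadraticSpray S hS).comp (phasePath (p.1, v)) -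
            (quadraticSpray S hS).comp (phasePath (p'.1, v))) := by
        rw [geodesicMap, geodesicMap, add_sub_add_comm, ← map_sub, sub_sub_sub_comm,
          ← map_sub (centeredPrimitive (E := E))]
      have h3 : ‖ContinuousLinearMap.const ℝ (Icc (0 : ℝ) 1) ((p.2 - p'.2) - (p.1 - p'.1))‖ ≤
          ‖(p.2 - p'.2) - (p.1 - p'.1)‖ :=
        (ContinuousMap.norm_le _ (norm_nonneg _)).2 fun t => le_rfl
      have h4 := norm_sub_le (p.2 - p'.2) (p.1 - p'.1)
      have h5 : ‖p.2 - p'.2‖ ≤ ‖p - p'‖ := norm_snd_le (p - p')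
      have h6 : ‖p.1 - p'.1‖ ≤ ‖p - p'‖ := norm_fst_le (p - p')
      have h7 := norm_centeredPrimitive_le ((quadraticSpray S hS).comp (phasePath (p.1, v)) -
            (quadraticSpray S hS).comp (phasePath (p'.1, v)))
      have h8 : C * ‖p.1 - p'.1‖ * ρ * ρ = 1 / 12 * ρ * ‖p.1 - p'.1‖ := by rw [← hCρ]; ring
      have h9 : ρ * ‖p.1 - p'.1‖ ≤ 1 / 12 * ‖p.1 - p'.1‖ :=
        mul_le_mul_of_nonneg_right hρ1 (norm_nonneg _)
      rw [h8] at h1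
      rw [h2]
      refine (norm_add_le _ _).trans ?_
      linarith [norm_nonneg (p.1 - p'.1)])
  refine ⟨V, fun z hz => ?_, fun z z' hz hz' => ?_, hVC⟩
  · obtain ⟨hVn, hfix⟩ := hV z hz
    refine ⟨?_, ?_, fun t ht => ?_⟩
    · have h1 := hspray z.1 z.1 (V z) 0 hVn.le (by simpa using hρ.le)
      rw [hzero, sub_zero, sub_self, norm_zero, zero_add, sub_zero] at h1
      have h2 := norm_centeredPrimitive_le ((quadraticSpray S hS).comp (phasePath (z.1, V z)))
      have h3 : ‖ContinuousLinearMap.const ℝ (Icc (0 : ℝ) 1) (z.2 - z.1)‖ ≤ ‖z.2 - z.1‖ :=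
        (ContinuousMap.norm_le _ (norm_nonneg _)).2 fun t => le_rfl
      have h4 : ‖V z‖ ≤ _ := (congrArg norm hfix).le.trans (norm_add_le
        (ContinuousLinearMap.const ℝ (Icc (0 : ℝ) 1) (z.2 - z.1))
        (centeredPrimitive ((quadraticSpray S hS).comp (phasePath (z.1, V z)))))
      have h5 : C * ‖V z‖ * ρ * ρ = 1 / 12 * ρ * ‖V z‖ := by rw [← hCρ]; ring
      have h6 : ρ * ‖V z‖ ≤ 1 / 12 * ‖V z‖ := mul_le_mul_of_nonneg_right hρ1 (norm_nonneg _)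
      rw [h5, hCρ] at h1
      linarith [norm_nonneg (V z)]
    · have := congrArg (fun w => primitive w 1) hfix
      simpa only [geodesicMap, map_add, ContinuousMap.add_apply, primitive_const_one,
        primitive_centeredPrimitive_one, add_zero] using this
    -- The fixed point equation exhibits `V z` as a primitive of the acceleration `q`.
    · set q := (quadraticSpray S hS).comp (phasePath (z.1, V z)) with hq
      have hder : HasDerivAt (fun t => (z.2 - z.1) + (pathIntegral q t - primitive (primitive q) 1))
          (pathExtend q t) t := ((hasDerivAt_pathIntegral q t).sub_const _).const_add _
      have hmem : Icc (0 : ℝ) 1 ∈ 𝓝 t := Icc_mem_nhds ht.1 ht.2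
      have hval : pathExtend q t =
          S (pathFrom z.1 (V z) t) (pathExtend (V z) t) (pathExtend (V z) t) := by
        have ht' := Ioo_subset_Icc_self ht
        rw [pathExtend_of_mem _ ht', pathExtend_of_mem _ ht', hq]
        simp [quadraticSpray, phasePath_apply, pathFrom]
      rw [hval] at hder
      refine hder.congr_of_eventuallyEq ?_
      filter_upwards [hmem] with s hs
      rw [pathExtend_of_mem _ hs]
      conv_lhs => rw [hfix]
      rfl
  · have := hVlip z hz z' hz'
    linarith

end BoundaryValue

/-! ### Metric fields and their geodesic equation -/

section Metric

variable {E : Type*} [NormedAddCommGroup E] [NormedSpace ℝ E]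

/-- A Riemannian metric `G` of class `C²`, given as a field of symmetric bilinear forms with the
field `H` of inverses from the dual space, and with quantitative bounds by `C`.
Only the right inverse property of `H` is recorded; with the bound on `H` it already yields uniform
ellipticity, see `IsMetricField.norm_le_sqrt`. -/
structure IsMetricField (C : ℝ) (G : E → E →L[ℝ] E →L[ℝ] ℝ) (H : E → (E →L[ℝ] ℝ) →L[ℝ] E) :
    Prop where
  one_le : 1 ≤ C
  contDiff : ContDiff ℝ 2 G
  contDiff_inv : ContDiff ℝ 1 H
  symm : ∀ x u v, G x u v = G x v u
  nonneg : ∀ x v, 0 ≤ G x v v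
  apply_inv : ∀ x φ, G x (H x φ) = φ
  norm_le : ∀ x, ‖G x‖ ≤ C
  norm_fderiv_le : ∀ x, ‖fderiv ℝ G x‖ ≤ C
  lipschitz_fderiv : ∀ x y, ‖fderiv ℝ G x - fderiv ℝ G y‖ ≤ C * ‖x - y‖
  norm_inv_le : ∀ x, ‖H x‖ ≤ C
  lipschitz_inv : ∀ x y, ‖H x - H y‖ ≤ C * ‖x - y‖

/-- The map sending a trilinear form `D`, thought of as the derivative of a metric, to the
trilinear form `(u, v, z) ↦ ½ D z u v - D u v z` of the Christoffel symbols of the first kind. -/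
noncomputable def christoffelForm :
    (E →L[ℝ] E →L[ℝ] E →L[ℝ] ℝ) →L[ℝ] (E →L[ℝ] E →L[ℝ] E →L[ℝ] ℝ) :=
  (1 / 2 : ℝ) •
    (ContinuousLinearMap.compL ℝ E (E →L[ℝ] E →L[ℝ] ℝ) (E →L[ℝ] E →L[ℝ] ℝ)
      (ContinuousLinearMap.flipₗᵢ ℝ E E ℝ : (E →L[ℝ] E →L[ℝ] ℝ) →L[ℝ] (E →L[ℝ] E →L[ℝ] ℝ))) ∘L
    (ContinuousLinearMap.flipₗᵢ ℝ E E (E →L[ℝ] ℝ) :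
      (E →L[ℝ] E →L[ℝ] E →L[ℝ] ℝ) →L[ℝ] (E →L[ℝ] E →L[ℝ] E →L[ℝ] ℝ)) -
  ContinuousLinearMap.id ℝ _

theorem christoffelForm_apply (D : E →L[ℝ] E →L[ℝ] E →L[ℝ] ℝ) (u v z : E) :
    christoffelForm D u v z = 1 / 2 * D z u v - D u v z := by
  simp [christoffelForm]

theorem norm_christoffelForm_le (D : E →L[ℝ] E →L[ℝ] E →L[ℝ] ℝ) :
    ‖christoffelForm D‖ ≤ 2 * ‖D‖ := by
  refine ContinuousLinearMap.opNorm_le_bound _ (by positivity) fun u => ?_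
  refine ContinuousLinearMap.opNorm_le_bound _ (by positivity) fun v => ?_
  refine ContinuousLinearMap.opNorm_le_bound _ (by positivity) fun z => ?_
  have h (a b c : E) : ‖D a b c‖ ≤ ‖D‖ * ‖a‖ * ‖b‖ * ‖c‖ :=
    (D a b).le_of_opNorm_le (D.le_opNorm₂ a b) c
  rw [christoffelForm_apply]
  refine (norm_sub_le _ _).trans ?_
  rw [norm_mul, Real.norm_of_nonneg (by norm_num : (0 : ℝ) ≤ 1 / 2)]
  have h1 := h z u v
  have h2 := h u v z
  have h3 : 0 ≤ ‖D‖ * ‖u‖ * ‖v‖ * ‖z‖ := by positivity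
  have h4 : ‖D‖ * ‖z‖ * ‖u‖ * ‖v‖ = ‖D‖ * ‖u‖ * ‖v‖ * ‖z‖ := by ring
  linarith

/-- The field `S` for which the geodesic equation reads `γ'' = S γ γ' γ'`. -/
noncomputable def geodesicSpray (G : E → E →L[ℝ] E →L[ℝ] ℝ) (H : E → (E →L[ℝ] ℝ) →L[ℝ] E)
    (x : E) : E →L[ℝ] E →L[ℝ] E :=
  (ContinuousLinearMap.compL ℝ E (E →L[ℝ] ℝ) E (H x)) ∘L christoffelForm (fderiv ℝ G x)

theorem geodesicSpray_apply (G : E → E →L[ℝ] E →L[ℝ] ℝ) (H : E → (E →L[ℝ] ℝ) →L[ℝ] E)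
    (x u v : E) : geodesicSpray G H x u v = H x (christoffelForm (fderiv ℝ G x) u v) := rfl

theorem norm_compl_christoffelForm_le (A : (E →L[ℝ] ℝ) →L[ℝ] E)
    (D : E →L[ℝ] E →L[ℝ] E →L[ℝ] ℝ) :
    ‖(ContinuousLinearMap.compL ℝ E (E →L[ℝ] ℝ) E A) ∘L christoffelForm D‖ ≤
      ‖A‖ * (2 * ‖D‖) := by
  refine ContinuousLinearMap.opNorm_le_bound₂ _ (by positivity) fun u v => ?_
  change ‖A (christoffelForm D u v)‖ ≤ _
  have h1 := ((christoffelForm D).le_opNorm₂ u v).trans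
    (mul_le_mul_of_nonneg_right (mul_le_mul_of_nonneg_right (norm_christoffelForm_le D)
      (norm_nonneg u)) (norm_nonneg v))
  refine (A.le_opNorm_of_le h1).trans (le_of_eq (by ring))

namespace IsMetricField

variable {C : ℝ} {G : E → E →L[ℝ] E →L[ℝ] ℝ} {H : E → (E →L[ℝ] ℝ) →L[ℝ] E}

theorem contDiff_geodesicSpray (h : IsMetricField C G H) : ContDiff ℝ 1 (geodesicSpray G H) := by
  have h1 : ContDiff ℝ 1 fun x => christoffelForm (fderiv ℝ G x) :=
    (christoffelForm (E := E)).contDiff.comp (h.contDiff.fderiv_right (by norm_num))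
  have h2 : ContDiff ℝ 1 fun x => ContinuousLinearMap.compL ℝ E (E →L[ℝ] ℝ) E (H x) :=
    (ContinuousLinearMap.compL ℝ E (E →L[ℝ] ℝ) E).contDiff.comp h.contDiff_inv
  exact h2.clm_comp h1

theorem norm_geodesicSpray_le (h : IsMetricField C G H) (x : E) :
    ‖geodesicSpray G H x‖ ≤ 4 * C ^ 2 := by
  have h0 := h.one_le
  refine (norm_compl_christoffelForm_le (H x) (fderiv ℝ G x)).trans ?_
  have : ‖H x‖ * (2 * ‖fderiv ℝ G x‖) ≤ C * (2 * C) := by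
    have := h.norm_inv_le x
    have := h.norm_fderiv_le x
    gcongr
  nlinarith

theorem lipschitz_geodesicSpray (h : IsMetricField C G H) (x y : E) :
    ‖geodesicSpray G H x - geodesicSpray G H y‖ ≤ 4 * C ^ 2 * ‖x - y‖ := by
  have h0 := h.one_le
  have hsplit : geodesicSpray G H x - geodesicSpray G H y =
      (ContinuousLinearMap.compL ℝ E (E →L[ℝ] ℝ) E (H x - H y)) ∘L
          christoffelForm (fderiv ℝ G x) +
        (ContinuousLinearMap.compL ℝ E (E →L[ℝ] ℝ) E (H y)) ∘L
          christoffelForm (fderiv ℝ G x - fderiv ℝ G y) := by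
    ext u v
    simp [geodesicSpray_apply]
  rw [hsplit]
  refine (norm_add_le _ _).trans ((add_le_add (norm_compl_christoffelForm_le _ _)
    (norm_compl_christoffelForm_le _ _)).trans ?_)
  have h1 : ‖H x - H y‖ * (2 * ‖fderiv ℝ G x‖) ≤ (C * ‖x - y‖) * (2 * C) := by
    have := h.lipschitz_inv x y
    have := h.norm_fderiv_le x
    gcongr
  have h2 : ‖H y‖ * (2 * ‖fderiv ℝ G x - fderiv ℝ G y‖) ≤ C * (2 * (C * ‖x - y‖)) := by
    have := h.lipschitz_fderiv x y
    have := h.norm_inv_le y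
    gcongr
  linarith

/-- The defining property of the spray: the geodesic equation is the Euler–Lagrange equation
`(G γ γ')' = ½ (fderiv G γ ·) γ' γ'` of the energy. -/
theorem apply_geodesicSpray (h : IsMetricField C G H) (x v z : E) :
    G x (geodesicSpray G H x v v) z =
      1 / 2 * fderiv ℝ G x z v v - fderiv ℝ G x v v z := by
  rw [geodesicSpray_apply, h.apply_inv, christoffelForm_apply]

theorem lipschitz (h : IsMetricField C G H) (x y : E) : ‖G x - G y‖ ≤ C * ‖x - y‖ :=
  convex_univ.norm_image_sub_le_of_norm_fderiv_le
    (fun z _ => h.contDiff.differentiable two_ne_zero z) (fun z _ => h.norm_fderiv_le z)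
    (mem_univ y) (mem_univ x)

theorem hasFDerivAt (h : IsMetricField C G H) (x : E) : HasFDerivAt G (fderiv ℝ G x) x :=
  (h.contDiff.differentiable two_ne_zero x).hasFDerivAt

theorem continuous_apply (h : IsMetricField C G H) {γ u w : ℝ → E} (hγ : Continuous γ)
    (hu : Continuous u) (hw : Continuous w) : Continuous fun t => G (γ t) (u t) (w t) := by
  have := h.contDiff.continuous
  fun_prop

/-- The Cauchy–Schwarz inequality for the metric. -/
theorem apply_sq_le (h : IsMetricField C G H) (x u v : E) :
    (G x u v) ^ 2 ≤ G x u u * G x v v := by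
  -- The quadratic polynomial `s ↦ G x (u + s • v) (u + s • v)` is nonnegative.
  have hdisc : discrim (G x v v) (2 * G x u v) (G x u u) ≤ 0 := by
    refine discrim_le_zero fun s => ?_
    have := h.nonneg x (u + s • v)
    simp only [map_add, map_smul, add_apply, smul_apply, smul_eq_mul, h.symm x v u] at this
    linarith
  rw [discrim] at hdisc
  linarith

theorem apply_le_sqrt_mul_sqrt (h : IsMetricField C G H) (x u v : E) :
    G x u v ≤ √(G x u u) * √(G x v v) := by
  rw [← Real.sqrt_mul (h.nonneg x u)]
  exact Real.le_sqrt_of_sq_le (h.apply_sq_le x u v)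

/-- The bound on the inverse makes the metric uniformly elliptic. -/
theorem norm_le_sqrt (h : IsMetricField C G H) (x v : E) : ‖v‖ ≤ C * √(G x v v) := by
  obtain ⟨φ, hφ, hφv⟩ := exists_dual_vector'' ℝ v
  have h0 := h.one_le
  have h1 : ‖v‖ = G x (H x φ) v := by rw [h.apply_inv, hφv]; rfl
  have h2 := h.apply_le_sqrt_mul_sqrt x (H x φ) v
  have h3 : G x (H x φ) (H x φ) ≤ C := by
    rw [h.apply_inv]
    refine (le_abs_self _).trans ((φ.le_of_opNorm_le hφ _).trans ?_)
    rw [one_mul]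
    refine ((H x).le_of_opNorm_le (h.norm_inv_le x) φ).trans ?_
    nlinarith
  have h4 : √(G x (H x φ) (H x φ)) ≤ C := by
    refine (Real.sqrt_le_left (by linarith)).2 (h3.trans ?_)
    nlinarith
  rw [h1]
  exact h2.trans (mul_le_mul_of_nonneg_right h4 (Real.sqrt_nonneg _))

/-- Lipschitz bound for the momentum, with the constant `6` that `exists_geodesic_velocity` gives
for the velocity. -/
theorem norm_momentum_sub_le (h : IsMetricField C G H) {x y u v : E} {d : ℝ}
    (hxy : ‖x - y‖ ≤ d) (huv : ‖u - v‖ ≤ 6 * d) (hu : ‖u‖ ≤ 1) :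
    ‖G x u - G y v‖ ≤ 7 * C * d := by
  have h0 := h.one_le
  have hsplit : G x u - G y v = (G x - G y) u + G y (u - v) := by simp
  have h1 : ‖(G x - G y) u‖ ≤ C * d * 1 := by
    refine (G x - G y).le_of_opNorm_le_of_le ((h.lipschitz x y).trans ?_) hu
    gcongr
  have h2 : ‖G y (u - v)‖ ≤ C * (6 * d) := (G y).le_of_opNorm_le_of_le (h.norm_le y) huv
  rw [hsplit]
  refine (norm_add_le _ _).trans ?_
  linarith

end IsMetricField

end Metric

/-! ### Conservation of speed and the first variation formula -/

namespace IsMetricField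

variable {E : Type*} [NormedAddCommGroup E] [NormedSpace ℝ E] [CompleteSpace E]
  {C : ℝ} {G : E → E →L[ℝ] E →L[ℝ] ℝ} {H : E → (E →L[ℝ] ℝ) →L[ℝ] E}
  {x : E} {v : C(Icc (0 : ℝ) 1, E)}

/-- The momentum `G γ γ'` of a geodesic, tested against a moving vector `w`: the weak form of the
Euler–Lagrange equation. -/
theorem hasDerivAt_momentum (h : IsMetricField C G H) {t : ℝ}
    (hv : HasDerivAt (pathExtend v)
      (geodesicSpray G H (pathFrom x v t) (pathExtend v t) (pathExtend v t)) t)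
    {w : ℝ → E} {w' : E} (hw : HasDerivAt w w' t) :
    HasDerivAt (fun t => G (pathFrom x v t) (pathExtend v t) (w t))
      (1 / 2 * fderiv ℝ G (pathFrom x v t) (w t) (pathExtend v t) (pathExtend v t) +
        G (pathFrom x v t) (pathExtend v t) w') t := by
  have h1 : HasDerivAt (fun t => G (pathFrom x v t))
      (fderiv ℝ G (pathFrom x v t) (pathExtend v t)) t :=
    (h.hasFDerivAt _).comp_hasDerivAt t (hasDerivAt_pathFrom x v t)
  have h2 := (h1.clm_apply hv).clm_apply hw
  refine h2.congr_deriv ?_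
  rw [add_apply, h.apply_geodesicSpray]
  ring

/-- Geodesics have constant speed. -/
theorem speed_eq (h : IsMetricField C G H)
    (hv : ∀ t ∈ Ioo (0 : ℝ) 1, HasDerivAt (pathExtend v)
      (geodesicSpray G H (pathFrom x v t) (pathExtend v t) (pathExtend v t)) t)
    {t : ℝ} (ht : t ∈ Icc (0 : ℝ) 1) :
    G (pathFrom x v t) (pathExtend v t) (pathExtend v t) =
      G x (v 0) (v 0) := by
  have hcont := h.continuous_apply (continuous_pathFrom x v) (continuous_pathExtend v)
    (continuous_pathExtend v)
  have hint := intervalIntegral.integral_eq_sub_of_hasDerivAt_of_le ht.1 hcont.continuousOn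
    (f' := fun _ => 0) (fun s hs => ?_) intervalIntegrable_const
  · rw [intervalIntegral.integral_zero, pathFrom_zero, pathExtend_zero] at hint
    linarith
  · have hs' := hv s ⟨hs.1, hs.2.trans_le ht.2⟩
    refine (h.hasDerivAt_momentum hs' hs').congr_deriv ?_
    rw [h.symm, h.apply_geodesicSpray]
    ring

/-- The first variation of the energy at a geodesic is given by boundary terms. -/
theorem integral_first_variation (h : IsMetricField C G H)
    (hv : ∀ t ∈ Ioo (0 : ℝ) 1, HasDerivAt (pathExtend v)
      (geodesicSpray G H (pathFrom x v t) (pathExtend v t) (pathExtend v t)) t)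
    (a : E) (u : C(Icc (0 : ℝ) 1, E)) :
    ∫ t in (0 : ℝ)..1,
        (1 / 2 * fderiv ℝ G (pathFrom x v t) (pathFrom a u t) (pathExtend v t) (pathExtend v t) +
          G (pathFrom x v t) (pathExtend v t) (pathExtend u t)) =
      G (pathFrom x v 1) (v 1) (pathFrom a u 1) - G x (v 0) a := by
  have hγ := continuous_pathFrom x v
  have hδ := continuous_pathFrom a u
  have hv' := continuous_pathExtend v
  have hu' := continuous_pathExtend u
  have hG' : Continuous (fderiv ℝ G) := h.contDiff.continuous_fderiv two_ne_zero
  have hG := h.continuous_apply hγ hv' hu'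
  rw [intervalIntegral.integral_eq_sub_of_hasDerivAt_of_le zero_le_one
    (h.continuous_apply hγ hv' hδ).continuousOn
    (fun t ht => h.hasDerivAt_momentum (hv t ht) (hasDerivAt_pathFrom a u t))
    (((continuous_const.mul
      ((((hG'.comp hγ).clm_apply hδ).clm_apply hv').clm_apply hv')).add hG).intervalIntegrable _ _),
    pathFrom_zero, pathFrom_zero, pathExtend_zero, pathExtend_one]

end IsMetricField

/-! ### The energy of short geodesics as a function of the end points -/

/-- The differential of the energy of short geodesics, in terms of the end points and of the
initial and final velocities. -/
noncomputable def boundaryForm {E : Type*} [NormedAddCommGroup E] [NormedSpace ℝ E]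
    (G : E → E →L[ℝ] E →L[ℝ] ℝ) (V : E × E → C(Icc (0 : ℝ) 1, E)) (z : E × E) :
    E × E →L[ℝ] ℝ :=
  (1 / 2 : ℝ) • ((G z.2 (V z 1)) ∘L .snd ℝ E E - (G z.1 (V z 0)) ∘L .fst ℝ E E)

namespace IsMetricField

variable {E : Type*} [NormedAddCommGroup E] [NormedSpace ℝ E] [CompleteSpace E]
  {C : ℝ} {G : E → E →L[ℝ] E →L[ℝ] ℝ} {H : E → (E →L[ℝ] ℝ) →L[ℝ] E}

/-- The energy `¼ ∫ G γ γ' γ'` of the curve issued from `p.1` with velocity `p.2`. -/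
noncomputable def pathEnergy (h : IsMetricField C G H) (p : E × C(Icc (0 : ℝ) 1, E)) : ℝ :=
  integralCLM ((⟨fun z : E × E => 1 / 4 * G z.1 z.2 z.2, by
    have := h.contDiff.continuous; fun_prop⟩ : C(E × E, ℝ)).comp (phasePath p))

theorem pathEnergy_eq (h : IsMetricField C G H) (x : E) (v : C(Icc (0 : ℝ) 1, E)) :
    h.pathEnergy (x, v) = ∫ t in (0 : ℝ)..1,
      1 / 4 * G (pathFrom x v t) (pathExtend v t) (pathExtend v t) := by
  rw [pathEnergy, integralCLM_apply]
  refine intervalIntegral.integral_congr fun t ht => ?_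
  rw [uIcc_of_le zero_le_one] at ht
  simp only [pathExtend_of_mem _ ht]
  simp [phasePath_apply, pathFrom]

/-- Differentiability of the energy at a curve, in the direction of the variation with origin `a`
and velocity `u`. -/
theorem hasFDerivAt_pathEnergy (h : IsMetricField C G H) (x : E) (v : C(Icc (0 : ℝ) 1, E)) :
    ∃ L : E × C(Icc (0 : ℝ) 1, E) →L[ℝ] ℝ, HasFDerivAt h.pathEnergy L (x, v) ∧
      ∀ a u, L (a, u) = 1 / 2 * ∫ t in (0 : ℝ)..1,
        (1 / 2 * fderiv ℝ G (pathFrom x v t) (pathFrom a u t) (pathExtend v t) (pathExtend v t) +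
          G (pathFrom x v t) (pathExtend v t) (pathExtend u t)) := by
  have hG : ContDiff ℝ 1 G := h.contDiff.of_le one_le_two
  have hq : ContDiff ℝ 1 fun z : E × E => 1 / 4 * G z.1 z.2 z.2 :=
    contDiff_const.mul
      (((hG.comp contDiff_fst).clm_apply contDiff_snd).clm_apply contDiff_snd)
  have hqd (z a : E × E) : fderiv ℝ (fun z : E × E => 1 / 4 * G z.1 z.2 z.2) z a =
      1 / 2 * (1 / 2 * fderiv ℝ G z.1 a.1 z.2 z.2 + G z.1 z.2 a.2) := by
    have h1 : HasFDerivAt (fun z : E × E => G z.1) (fderiv ℝ G z.1 ∘L .fst ℝ E E) z :=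
      (h.hasFDerivAt z.1).comp z hasFDerivAt_fst
    have h2 := ((h1.clm_apply hasFDerivAt_snd).clm_apply hasFDerivAt_snd).const_mul (1 / 4)
    rw [h2.fderiv]
    simp [h.symm z.1 a.2 z.2]
    ring
  have hint : HasFDerivAt (fun w : C(Icc (0 : ℝ) 1, ℝ) => integralCLM w) integralCLM
      ((⟨fun z : E × E => 1 / 4 * G z.1 z.2 z.2, hq.continuous⟩ : C(E × E, ℝ)).comp
        (phasePath (x, v))) :=
    (integralCLM (E := ℝ)).hasFDerivAt
  have hpp : HasFDerivAt (fun p : E × C(Icc (0 : ℝ) 1, E) => phasePath p) phasePath (x, v) :=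
    (phasePath (E := E)).hasFDerivAt
  refine ⟨_, hint.comp (x, v) ((hasFDerivAt_superposition hq (phasePath (x, v))).comp (x, v) hpp),
    fun a u => ?_⟩
  change integralCLM _ = _
  rw [integralCLM_apply, ← intervalIntegral.integral_const_mul]
  refine intervalIntegral.integral_congr fun t ht => ?_
  rw [uIcc_of_le zero_le_one] at ht
  simp only [pathExtend_of_mem _ ht]
  change fderiv ℝ (fun z : E × E => 1 / 4 * G z.1 z.2 z.2) (phasePath (x, v) ⟨t, ht⟩)
    (phasePath (a, u) ⟨t, ht⟩) = _
  rw [phasePath_apply, phasePath_apply, hqd]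
  rfl

/-- Close end points `x`, `y` are joined by a geodesic of constant speed whose energy `e (x, y)`
is of class `C²` with bounded Hessian. -/
theorem exists_energy (h : IsMetricField C G H) :
    ∃ (V : E × E → C(Icc (0 : ℝ) 1, E)) (e : E × E → ℝ),
      (∀ z : E × E, ‖z.2 - z.1‖ < 1 / (24 * (4 * C ^ 2)) → primitive (V z) 1 = z.2 - z.1 ∧
        (∀ t ∈ Icc (0 : ℝ) 1, G (pathFrom z.1 (V z) t) (pathExtend (V z) t) (pathExtend (V z) t) =
          4 * e z) ∧
        HasFDerivAt e (boundaryForm G V z) z) ∧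
      (∀ x, e (x, x) = 0) ∧ ContDiffOn ℝ 2 e {z | ‖z.2 - z.1‖ < 1 / (24 * (4 * C ^ 2))} ∧
      ∀ z : E × E, ‖z.2 - z.1‖ < 1 / (24 * (4 * C ^ 2)) →
        ‖fderiv ℝ (fderiv ℝ e) z‖ ≤ 7 * C := by
  have h0 := h.one_le
  obtain ⟨V, hV, hVlip, hVC⟩ := exists_geodesic_velocity h.contDiff_geodesicSpray
    (by nlinarith : 1 ≤ 4 * C ^ 2) h.norm_geodesicSpray_le h.lipschitz_geodesicSpray
  have hr : 1 / (24 * (4 * C ^ 2)) ≤ 1 / 2 := by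
    refine one_div_le_one_div_of_le (by norm_num) ?_
    nlinarith
  have hr0 : 0 < 1 / (24 * (4 * C ^ 2)) := by positivity
  set r : ℝ := 1 / (24 * (4 * C ^ 2))
  set U : Set (E × E) := {z | ‖z.2 - z.1‖ < r} with hUdef
  have hU : IsOpen U := isOpen_lt (by fun_prop) continuous_const
  -- By conservation of speed, the energy is determined by the initial velocity.
  set e : E × E → ℝ := fun z => 1 / 4 * G z.1 (V z 0) (V z 0) with he
  have hspeed : ∀ z ∈ U, ∀ t ∈ Icc (0 : ℝ) 1,
      G (pathFrom z.1 (V z) t) (pathExtend (V z) t) (pathExtend (V z) t) = 4 * e z := by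
    intro z hz t ht
    rw [h.speed_eq (hV z hz).2.2 ht, he]
    ring
  have heq : ∀ z ∈ U, e z = h.pathEnergy (z.1, V z) := by
    intro z hz
    rw [pathEnergy_eq]
    have : ∫ t in (0 : ℝ)..1,
        1 / 4 * G (pathFrom z.1 (V z) t) (pathExtend (V z) t) (pathExtend (V z) t) =
        ∫ t in (0 : ℝ)..1, e z := by
      refine intervalIntegral.integral_congr fun t ht => ?_
      rw [uIcc_of_le zero_le_one] at ht
      simp only [hspeed z hz t ht]
      ring
    rw [this]
    simp
  have hder : ∀ z ∈ U, HasFDerivAt e (boundaryForm G V z) z := by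
    intro z hz
    have hUz : U ∈ 𝓝 z := hU.mem_nhds hz
    have hVd : HasFDerivAt V (fderiv ℝ V z) z :=
      ((hVC.contDiffAt hUz).differentiableAt one_ne_zero).hasFDerivAt
    obtain ⟨L, hL, hLapply⟩ := h.hasFDerivAt_pathEnergy z.1 (V z)
    have hcomp : HasFDerivAt (fun z : E × E => h.pathEnergy (z.1, V z))
        (L ∘L (ContinuousLinearMap.fst ℝ E E).prod (fderiv ℝ V z)) z :=
      HasFDerivAt.comp (f := fun z : E × E => (z.1, V z)) z hL (hasFDerivAt_fst.prodMk hVd)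
    have hcomp' := hcomp.congr_of_eventuallyEq (f₁ := e)
      (by filter_upwards [hUz] with w hw using heq w hw)
    -- The derivative of the constraint `∫ V z = z.2 - z.1`.
    have hend : ∀ a : E × E, primitive (fderiv ℝ V z a) 1 = a.2 - a.1 := by
      have hi : HasFDerivAt (fun w : C(Icc (0 : ℝ) 1, E) => integralCLM w) integralCLM (V z) :=
        (integralCLM (E := E)).hasFDerivAt
      have h1 : HasFDerivAt (fun z => integralCLM (V z)) (integralCLM ∘L fderiv ℝ V z) z :=
        hi.comp z hVd
      have h2 : HasFDerivAt (fun z : E × E => z.2 - z.1) (.snd ℝ E E - .fst ℝ E E) z :=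
        hasFDerivAt_snd.sub hasFDerivAt_fst
      have h3 := h1.unique (h2.congr_of_eventuallyEq
        (by filter_upwards [hUz] with w hw using (hV w hw).2.1))
      intro a
      exact DFunLike.congr_fun h3 a
    refine hcomp'.congr_fderiv (ContinuousLinearMap.ext fun a => ?_)
    have hL2 := hLapply a.1 (fderiv ℝ V z a)
    rw [h.integral_first_variation (hV z hz).2.2, pathFrom_one, pathFrom_one, hend,
      (hV z hz).2.1, add_sub_cancel, add_sub_cancel] at hL2
    simpa [boundaryForm] using hL2
  have hfd : ∀ z ∈ U, fderiv ℝ e z = boundaryForm G V z := fun z hz => (hder z hz).fderiv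
  have hBC : ContDiffOn ℝ 1 (boundaryForm G V) U := by
    have hG : ContDiff ℝ 1 G := h.contDiff.of_le one_le_two
    have hev : ∀ t : Icc (0 : ℝ) 1, ContDiffOn ℝ 1 (fun z => V z t) U := fun t =>
      (ContinuousLinearMap.contDiff (F := E)
        (ContinuousMap.evalCLM ℝ t : C(Icc (0 : ℝ) 1, E) →L[ℝ] E)).comp_contDiffOn hVC
    have h1 : ContDiffOn ℝ 1 (fun z : E × E => G z.2 (V z 1)) U :=
      (hG.comp contDiff_snd).contDiffOn.clm_apply (hev 1)
    have h2 : ContDiffOn ℝ 1 (fun z : E × E => G z.1 (V z 0)) U :=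
      (hG.comp contDiff_fst).contDiffOn.clm_apply (hev 0)
    exact ((h1.clm_comp contDiffOn_const).sub (h2.clm_comp contDiffOn_const)).const_smul _
  have hfdC : ContDiffOn ℝ 1 (fderiv ℝ e) U := hBC.congr hfd
  refine ⟨V, e, fun z hz => ⟨(hV z hz).2.1, hspeed z hz, hder z hz⟩, fun x => ?_, ?_,
    fun z hz => ?_⟩
  · have hx := (hV (x, x) (by simpa using hr0)).1
    rw [sub_self, norm_zero, mul_zero, norm_le_zero_iff] at hx
    simp [he, hx]
  · refine (contDiffOn_succ_iff_fderiv_of_isOpen (n := 1) hU).2 ⟨fun z hz =>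
      (hder z hz).differentiableAt.differentiableWithinAt, fun hn => ?_, hfdC⟩
    exact absurd hn (by simp)
  · have hUz : U ∈ 𝓝 z := hU.mem_nhds hz
    have hd := ((hfdC.contDiffAt hUz).differentiableAt one_ne_zero).hasFDerivAt
    refine hd.le_of_lip' (by linarith) ?_
    filter_upwards [hUz] with w hw
    rw [hfd w hw, hfd z hz]
    have hVwz := hVlip w z hw hz
    have hVt (t : Icc (0 : ℝ) 1) : ‖V w t - V z t‖ ≤ 6 * ‖w - z‖ :=
      ((V w - V z).norm_coe_le_norm t).trans hVwz
    have hVw (t : Icc (0 : ℝ) 1) : ‖V w t‖ ≤ 1 := ((V w).norm_coe_le_norm t).trans (by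
      have h1 := (hV w hw).1
      have h2 : ‖w.2 - w.1‖ < r := hw
      linarith)
    have h1 := h.norm_momentum_sub_le (norm_snd_le (w - z)) (hVt 1) (hVw 1)
    have h2 := h.norm_momentum_sub_le (norm_fst_le (w - z)) (hVt 0) (hVw 0)
    refine ContinuousLinearMap.opNorm_le_bound _ (by positivity) fun a => ?_
    have hsplit : (boundaryForm G V w - boundaryForm G V z) a =
        1 / 2 * ((G w.2 (V w 1) - G z.2 (V z 1)) a.2 - (G w.1 (V w 0) - G z.1 (V z 0)) a.1) := by
      simp [boundaryForm]
      ring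
    rw [hsplit, norm_mul, Real.norm_of_nonneg (by norm_num : (0 : ℝ) ≤ 1 / 2)]
    have h3 := (G w.2 (V w 1) - G z.2 (V z 1)).le_of_opNorm_le_of_le h1 (norm_snd_le a)
    have h4 := (G w.1 (V w 0) - G z.1 (V z 0)).le_of_opNorm_le_of_le h2 (norm_fst_le a)
    have h5 := norm_sub_le ((G w.2 (V w 1) - G z.2 (V z 1)) a.2)
      ((G w.1 (V w 0) - G z.1 (V z 0)) a.1)
    linarith

end IsMetricField

/-! ### Minimality of short geodesics -/

section Distance

variable {E : Type*} [NormedAddCommGroup E] [NormedSpace ℝ E]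

/-- Half the Riemannian length of a curve over `[0, 1]`. -/
noncomputable def riemannHalfLength (G : E → E →L[ℝ] E →L[ℝ] ℝ) (c : ℝ → E) : ℝ :=
  ∫ t in (0 : ℝ)..1,
    1 / 2 * √(G (c t) (derivWithin c (Icc 0 1) t) (derivWithin c (Icc 0 1) t))

/-- The distance obtained by minimizing `riemannHalfLength` over the `C¹` curves on `[0, 1]`. -/
noncomputable def riemannDist (G : E → E →L[ℝ] E →L[ℝ] ℝ) (x y : E) : ℝ :=
  sInf {ℓ : ℝ | ∃ c : ℝ → E, ContDiffOn ℝ 1 c (Icc 0 1) ∧ c 0 = x ∧ c 1 = y ∧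
    ℓ = riemannHalfLength G c}

theorem riemannHalfLength_nonneg (G : E → E →L[ℝ] E →L[ℝ] ℝ) (c : ℝ → E) :
    0 ≤ riemannHalfLength G c :=
  intervalIntegral.integral_nonneg zero_le_one fun _ _ => by positivity

theorem riemannDist_le (G : E → E →L[ℝ] E →L[ℝ] ℝ) {c : ℝ → E} (hc : ContDiffOn ℝ 1 c (Icc 0 1)) :
    riemannDist G (c 0) (c 1) ≤ riemannHalfLength G c :=
  csInf_le ⟨0, by rintro _ ⟨c, -, -, -, rfl⟩; exact riemannHalfLength_nonneg G c⟩
    ⟨c, hc, rfl, rfl, rfl⟩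

theorem exists_riemannHalfLength_lt {G : E → E →L[ℝ] E →L[ℝ] ℝ} {x y : E} {a : ℝ}
    (h : riemannDist G x y < a) :
    ∃ c : ℝ → E, ContDiffOn ℝ 1 c (Icc 0 1) ∧ c 0 = x ∧ c 1 = y ∧ riemannHalfLength G c < a := by
  have hne : {ℓ : ℝ | ∃ c : ℝ → E, ContDiffOn ℝ 1 c (Icc 0 1) ∧ c 0 = x ∧ c 1 = y ∧
      ℓ = riemannHalfLength G c}.Nonempty :=
    ⟨_, fun t => x + t • (y - x), by fun_prop, by simp, by simp, rfl⟩
  obtain ⟨_, ⟨c, hc, h0, h1, rfl⟩, hlt⟩ := exists_lt_of_csInf_lt hne h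
  exact ⟨c, hc, h0, h1, hlt⟩

theorem hasDerivAt_derivWithin_Icc {c : ℝ → E} (hc : ContDiffOn ℝ 1 c (Icc 0 1)) {t : ℝ}
    (ht : t ∈ Ioo (0 : ℝ) 1) : HasDerivAt c (derivWithin c (Icc 0 1) t) t :=
  ((hc.differentiableOn one_ne_zero t (Ioo_subset_Icc_self ht)).hasDerivWithinAt).hasDerivAt
    (Icc_mem_nhds ht.1 ht.2)

/-- A curve of constant speed and energy `e` has half-length `√e`. -/
theorem riemannHalfLength_pathFrom [CompleteSpace E] {G : E → E →L[ℝ] E →L[ℝ] ℝ} {x : E}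
    {v : C(Icc (0 : ℝ) 1, E)} {e : ℝ}
    (hspeed : ∀ t ∈ Icc (0 : ℝ) 1,
      G (pathFrom x v t) (pathExtend v t) (pathExtend v t) = 4 * e) :
    riemannHalfLength G (pathFrom x v) = √e := by
  have hconst : ∀ t ∈ uIcc (0 : ℝ) 1, 1 / 2 * √(G (pathFrom x v t)
      (derivWithin (pathFrom x v) (Icc 0 1) t) (derivWithin (pathFrom x v) (Icc 0 1) t)) = √e := by
    intro t ht
    rw [uIcc_of_le zero_le_one] at ht
    rw [(hasDerivAt_pathFrom x v t).hasDerivWithinAt.derivWithin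
      (uniqueDiffOn_Icc zero_lt_one t ht), hspeed t ht, Real.sqrt_mul (by norm_num),
      show (4 : ℝ) = 2 ^ 2 by norm_num, Real.sqrt_sq (by norm_num)]
    ring
  rw [riemannHalfLength, intervalIntegral.integral_congr hconst]
  simp

end Distance

namespace IsMetricField

variable {E : Type*} [NormedAddCommGroup E] [NormedSpace ℝ E]
  {C : ℝ} {G : E → E →L[ℝ] E →L[ℝ] ℝ} {H : E → (E →L[ℝ] ℝ) →L[ℝ] E}

theorem continuousOn_speed (h : IsMetricField C G H) {c : ℝ → E}
    (hc : ContDiffOn ℝ 1 c (Icc 0 1)) :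
    ContinuousOn (fun t => √(G (c t) (derivWithin c (Icc 0 1) t) (derivWithin c (Icc 0 1) t)))
      (Icc 0 1) := by
  have hd : ContinuousOn (derivWithin c (Icc 0 1)) (Icc 0 1) :=
    hc.continuousOn_derivWithin (uniqueDiffOn_Icc zero_lt_one) le_rfl
  have hG : ContinuousOn (fun t => G (c t)) (Icc 0 1) :=
    h.contDiff.continuous.comp_continuousOn hc.continuousOn
  exact ((hG.clm_apply hd).clm_apply hd).sqrt

/-- A curve cannot go far from its origin without being long. -/
theorem norm_sub_le_riemannHalfLength [CompleteSpace E] (h : IsMetricField C G H) {c : ℝ → E}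
    (hc : ContDiffOn ℝ 1 c (Icc 0 1)) {t : ℝ} (ht : t ∈ Icc (0 : ℝ) 1) :
    ‖c t - c 0‖ ≤ 2 * C * riemannHalfLength G c := by
  have h0 := h.one_le
  have hd : ContinuousOn (derivWithin c (Icc 0 1)) (Icc 0 1) :=
    hc.continuousOn_derivWithin (uniqueDiffOn_Icc zero_lt_one) le_rfl
  have hsub : Icc 0 t ⊆ Icc (0 : ℝ) 1 := Icc_subset_Icc_right ht.2
  have hs := h.continuousOn_speed hc
  have hi01 : IntervalIntegrable (fun t => C * √(G (c t) (derivWithin c (Icc 0 1) t)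
      (derivWithin c (Icc 0 1) t))) MeasureTheory.volume 0 1 :=
    (continuousOn_const.mul hs).intervalIntegrable_of_Icc zero_le_one
  have hi0t : IntervalIntegrable (fun t => C * √(G (c t) (derivWithin c (Icc 0 1) t)
      (derivWithin c (Icc 0 1) t))) MeasureTheory.volume 0 t :=
    ((continuousOn_const.mul hs).mono hsub).intervalIntegrable_of_Icc ht.1
  rw [← intervalIntegral.integral_eq_sub_of_hasDerivAt_of_le ht.1 (hc.continuousOn.mono hsub)
    (fun s hs => hasDerivAt_derivWithin_Icc hc ⟨hs.1, hs.2.trans_le ht.2⟩)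
    ((hd.mono hsub).intervalIntegrable_of_Icc ht.1)]
  refine (intervalIntegral.norm_integral_le_integral_norm ht.1).trans ?_
  refine (intervalIntegral.integral_mono_on ht.1
    ((hd.mono hsub).norm.intervalIntegrable_of_Icc ht.1) hi0t
    fun s _ => h.norm_le_sqrt (c s) _).trans ?_
  refine (intervalIntegral.integral_mono_interval le_rfl ht.1 ht.2
    (.of_forall fun s => by positivity) hi01).trans (le_of_eq ?_)
  rw [riemannHalfLength, intervalIntegral.integral_const_mul, intervalIntegral.integral_const_mul]
  ring

/-- Short geodesics are no longer than the `C¹` curves that stay close to their origin. The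
function `y ↦ √(e (x, y))` is a calibration: by the first variation formula its differential is
bounded by half the metric norm. Its singularity at `y = x` is removed by adding `ε ^ 2` under the
square root. -/
theorem sqrt_energy_le_riemannHalfLength (h : IsMetricField C G H)
    {V : E × E → C(Icc (0 : ℝ) 1, E)} {e : E × E → ℝ} {r : ℝ}
    (hspeed : ∀ z : E × E, ‖z.2 - z.1‖ < r → G z.2 (V z 1) (V z 1) = 4 * e z)
    (hder : ∀ z : E × E, ‖z.2 - z.1‖ < r → HasFDerivAt e (boundaryForm G V z) z)
    (hdiag : ∀ x, e (x, x) = 0) {c : ℝ → E} (hc : ContDiffOn ℝ 1 c (Icc 0 1))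
    (hr : ∀ t ∈ Icc (0 : ℝ) 1, ‖c t - c 0‖ < r) :
    √(e (c 0, c 1)) ≤ riemannHalfLength G c := by
  have hnonneg : ∀ t ∈ Icc (0 : ℝ) 1, 0 ≤ e (c 0, c t) := by
    intro t ht
    have h1 := hspeed (c 0, c t) (hr t ht)
    have h2 := h.nonneg (c t) (V (c 0, c t) 1)
    linarith
  refine le_of_forall_pos_le_add fun ε hε => ?_
  have hcont : ContinuousOn (fun t => √(e (c 0, c t) + ε ^ 2)) (Icc 0 1) := by
    refine ContinuousOn.sqrt (ContinuousOn.add (fun t ht => ?_) continuousOn_const)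
    have h1 : ContinuousAt e (c 0, c t) := (hder (c 0, c t) (hr t ht)).continuousAt
    exact ContinuousAt.comp_continuousWithinAt (f := fun t => (c 0, c t)) (x := t) h1
      (continuousWithinAt_const.prodMk (hc.continuousOn t ht))
  have hderiv : ∀ t ∈ Ioo (0 : ℝ) 1, HasDerivAt (fun t => √(e (c 0, c t) + ε ^ 2))
      (1 / 2 * G (c t) (V (c 0, c t) 1) (derivWithin c (Icc 0 1) t) /
        (2 * √(e (c 0, c t) + ε ^ 2))) t := by
    intro t ht
    have ht' := Ioo_subset_Icc_self ht
    have h1 : HasDerivAt (fun t => (c 0, c t)) (0, derivWithin c (Icc 0 1) t) t :=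
      (hasDerivAt_const t (c 0)).prodMk (hasDerivAt_derivWithin_Icc hc ht)
    have h2 := HasFDerivAt.comp_hasDerivAt t (f := fun t => (c 0, c t))
      (hder (c 0, c t) (hr t ht')) h1
    have h3 : HasDerivAt (fun t => e (c 0, c t) + ε ^ 2)
        (1 / 2 * G (c t) (V (c 0, c t) 1) (derivWithin c (Icc 0 1) t)) t := by
      refine (h2.add_const (ε ^ 2)).congr_deriv ?_
      simp [boundaryForm]
    have hpos : e (c 0, c t) + ε ^ 2 ≠ 0 := by
      have := hnonneg t ht'
      positivity
    exact h3.sqrt hpos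
  have hint : MeasureTheory.IntegrableOn (fun t => 1 / 2 * √(G (c t) (derivWithin c (Icc 0 1) t)
      (derivWithin c (Icc 0 1) t))) (Icc 0 1) :=
    (continuousOn_const.mul (h.continuousOn_speed hc)).integrableOn_Icc
  have hkey := intervalIntegral.sub_le_integral_of_hasDeriv_right_of_le zero_le_one hcont
    (fun t ht => (hderiv t ht).hasDerivWithinAt) hint (fun t ht => ?_)
  · rw [hdiag, zero_add, Real.sqrt_sq hε.le] at hkey
    have hmono : √(e (c 0, c 1)) ≤ √(e (c 0, c 1) + ε ^ 2) :=
      Real.sqrt_le_sqrt (by nlinarith)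
    rw [riemannHalfLength]
    linarith
  · have ht' := Ioo_subset_Icc_self ht
    have he := hnonneg t ht'
    have hpos : 0 < √(e (c 0, c t) + ε ^ 2) := by positivity
    have h1 := h.apply_le_sqrt_mul_sqrt (c t) (V (c 0, c t) 1) (derivWithin c (Icc 0 1) t)
    have h2 : √(G (c t) (V (c 0, c t) 1) (V (c 0, c t) 1)) ≤ 2 * √(e (c 0, c t) + ε ^ 2) := by
      have := hspeed (c 0, c t) (hr t ht')
      simp only at this
      rw [this, Real.sqrt_le_left (by positivity), mul_pow, Real.sq_sqrt (by positivity)]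
      nlinarith
    rw [div_le_iff₀ (by positivity)]
    have h3 := mul_le_mul_of_nonneg_right h2
      (Real.sqrt_nonneg (G (c t) (derivWithin c (Icc 0 1) t) (derivWithin c (Icc 0 1) t)))
    linarith

/-- The squared distance is `C²` with bounded Hessian near the diagonal. -/
theorem contDiffOn_riemannDist_sq [CompleteSpace E] (h : IsMetricField C G H) :
    IsOpen {z : E × E | riemannDist G z.1 z.2 < 1 / (24 * (4 * C ^ 2)) / (2 * C)} ∧
    ContDiffOn ℝ 2 (fun z : E × E => riemannDist G z.1 z.2 ^ 2)
      {z : E × E | riemannDist G z.1 z.2 < 1 / (24 * (4 * C ^ 2)) / (2 * C)} ∧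
    ∀ z : E × E, riemannDist G z.1 z.2 < 1 / (24 * (4 * C ^ 2)) / (2 * C) →
      ‖iteratedFDeriv ℝ 2 (fun z : E × E => riemannDist G z.1 z.2 ^ 2) z‖ ≤ 7 * C := by
  have h0 := h.one_le
  obtain ⟨V, e, hV, hdiag, heC, hess⟩ := h.exists_energy
  set r : ℝ := 1 / (24 * (4 * C ^ 2))
  set Υ : ℝ := r / (2 * C) with hΥ
  have hrpos : 0 < r := by positivity
  have hΥpos : 0 < Υ := by positivity
  have hΥr : 2 * C * Υ = r := by rw [hΥ]; field_simp
  have hspeed : ∀ z : E × E, ‖z.2 - z.1‖ < r → G z.2 (V z 1) (V z 1) = 4 * e z := by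
    intro z hz
    have := (hV z hz).2.1 1 (right_mem_Icc.2 zero_le_one)
    rwa [pathFrom_one, (hV z hz).1, add_sub_cancel, pathExtend_one] at this
  have hder : ∀ z : E × E, ‖z.2 - z.1‖ < r → HasFDerivAt e (boundaryForm G V z) z :=
    fun z hz => (hV z hz).2.2
  have hnonneg : ∀ z : E × E, ‖z.2 - z.1‖ < r → 0 ≤ e z := by
    intro z hz
    have h1 := hspeed z hz
    have h2 := h.nonneg z.2 (V z 1)
    linarith
  have hupper : ∀ z : E × E, ‖z.2 - z.1‖ < r → riemannDist G z.1 z.2 ≤ √(e z) := by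
    intro z hz
    have := riemannDist_le G (contDiff_pathFrom z.1 (V z)).contDiffOn
    rwa [riemannHalfLength_pathFrom (hV z hz).2.1, pathFrom_zero, pathFrom_one, (hV z hz).1,
      add_sub_cancel] at this
  -- A curve of half-length less than `Υ` cannot leave the ball on which `e` calibrates.
  have hlower : ∀ c : ℝ → E, ContDiffOn ℝ 1 c (Icc 0 1) → riemannHalfLength G c < Υ →
      ‖c 1 - c 0‖ < r ∧ √(e (c 0, c 1)) ≤ riemannHalfLength G c := by
    intro c hc hlt
    have hball : ∀ t ∈ Icc (0 : ℝ) 1, ‖c t - c 0‖ < r := by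
      intro t ht
      refine (h.norm_sub_le_riemannHalfLength hc ht).trans_lt ?_
      rw [← hΥr]
      gcongr
    exact ⟨hball 1 (right_mem_Icc.2 zero_le_one),
      h.sqrt_energy_le_riemannHalfLength hspeed hder hdiag hc hball⟩
  have hdist : ∀ z : E × E, riemannDist G z.1 z.2 < Υ →
      ‖z.2 - z.1‖ < r ∧ riemannDist G z.1 z.2 = √(e z) := by
    rintro ⟨x, y⟩ hz
    obtain ⟨c, hc, rfl, rfl, hlt⟩ := exists_riemannHalfLength_lt hz
    obtain ⟨hnear, -⟩ := hlower c hc hlt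
    refine ⟨hnear, le_antisymm (hupper (c 0, c 1) hnear) (le_of_forall_gt fun a ha => ?_)⟩
    obtain ⟨c', hc', h0', h1', hlt'⟩ := exists_riemannHalfLength_lt (lt_min hz ha)
    have := (hlower c' hc' (hlt'.trans_le (min_le_left _ _))).2
    rw [h0', h1'] at this
    exact this.trans_lt (hlt'.trans_le (min_le_right _ _))
  set U : Set (E × E) := {z | ‖z.2 - z.1‖ < r} with hUdef
  have hU : IsOpen U := isOpen_lt (by fun_prop) continuous_const
  have hset : {z : E × E | riemannDist G z.1 z.2 < Υ} = U ∩ e ⁻¹' Iio (Υ ^ 2) := by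
    ext z
    constructor
    · intro hz
      obtain ⟨hzU, heq⟩ := hdist z hz
      refine ⟨hzU, ?_⟩
      have hz' : riemannDist G z.1 z.2 < Υ := hz
      rw [heq, Real.sqrt_lt' hΥpos] at hz'
      exact hz'
    · rintro ⟨hzU, hz⟩
      exact (hupper z hzU).trans_lt ((Real.sqrt_lt' hΥpos).2 hz)
  have hopen : IsOpen {z : E × E | riemannDist G z.1 z.2 < Υ} := by
    rw [hset]
    exact heC.continuousOn.isOpen_inter_preimage hU isOpen_Iio
  have heq : ∀ z ∈ {z : E × E | riemannDist G z.1 z.2 < Υ},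
      riemannDist G z.1 z.2 ^ 2 = e z := by
    intro z hz
    obtain ⟨hzU, heq⟩ := hdist z hz
    rw [heq, Real.sq_sqrt (hnonneg z hzU)]
  refine ⟨hopen, (heC.mono fun z hz => (hdist z hz).1).congr heq, fun z hz => ?_⟩
  have hev : (fun z : E × E => riemannDist G z.1 z.2 ^ 2) =ᶠ[𝓝 z] e := by
    filter_upwards [hopen.mem_nhds hz] with w hw using heq w hw
  rw [(hev.iteratedFDeriv ℝ 2).eq_of_nhds, show 2 = 1 + 1 from rfl, ← norm_iteratedFDeriv_fderiv,
    norm_iteratedFDeriv_one]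
  exact hess z (hdist z hz).1

end IsMetricField

/-! ### From matrix fields to metric fields -/

section Combination

variable {ι E F : Type*} [Fintype ι] [NormedAddCommGroup E] [NormedSpace ℝ E]
  [NormedAddCommGroup F] [NormedSpace ℝ F]

/-- The constant by which bounds on coefficients turn into bounds on a combination of the vectors
`L`. -/
noncomputable def combinationConst (L : ι → F) : ℝ :=
  ∑ p, ‖(ContinuousLinearMap.id ℝ ℝ).smulRight (L p)‖

theorem contDiff_combination {f : ι → E → ℝ} (hf : ∀ p, ContDiff ℝ 2 (f p)) (L : ι → F) :
    ContDiff ℝ 2 fun x => ∑ p, f p x • L p :=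
  ContDiff.sum fun p _ => (hf p).smul contDiff_const

theorem norm_iteratedFDeriv_combination_le {f : ι → E → ℝ} (hf : ∀ p, ContDiff ℝ 2 (f p))
    {M : ℝ} {k : ℕ} (hk : k ≤ 2) {x : E} (hM : ∀ p, ‖iteratedFDeriv ℝ k (f p) x‖ ≤ M)
    (L : ι → F) :
    ‖iteratedFDeriv ℝ k (fun x => ∑ p, f p x • L p) x‖ ≤ combinationConst L * M := by
  have hk' : (k : WithTop ℕ∞) ≤ 2 := by exact_mod_cast hk
  -- Each term is the composition of `f p` with a continuous linear map.
  have hterm : ∀ p, (fun x => f p x • L p) = (ContinuousLinearMap.id ℝ ℝ).smulRight (L p) ∘ f p :=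
    fun p => rfl
  have hterm' : ∀ p ∈ Finset.univ, ContDiffAt ℝ k (fun x => f p x • L p) x := fun p _ =>
    (((hf p).smul contDiff_const).of_le hk').contDiffAt
  rw [iteratedFDeriv_fun_sum_apply hterm',
    combinationConst, Finset.sum_mul]
  refine norm_sum_le_of_le _ fun p _ => ?_
  rw [hterm, ContinuousLinearMap.iteratedFDeriv_comp_left _ (hf p).contDiffAt hk']
  exact (ContinuousLinearMap.norm_compContinuousMultilinearMap_le _ _).trans
    (mul_le_mul_of_nonneg_left (hM p) (norm_nonneg _))

variable {B : ℝ} {A : E → F}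

theorem norm_le_of_iteratedFDeriv (hB : ∀ k ≤ 2, ∀ x, ‖iteratedFDeriv ℝ k A x‖ ≤ B) (x : E) :
    ‖A x‖ ≤ B := by
  simpa using hB 0 (by norm_num) x

theorem norm_fderiv_le_of_iteratedFDeriv (hB : ∀ k ≤ 2, ∀ x, ‖iteratedFDeriv ℝ k A x‖ ≤ B)
    (x : E) : ‖fderiv ℝ A x‖ ≤ B := by
  simpa [norm_iteratedFDeriv_one] using hB 1 (by norm_num) x

theorem lipschitz_of_iteratedFDeriv (hA : ContDiff ℝ 2 A)
    (hB : ∀ k ≤ 2, ∀ x, ‖iteratedFDeriv ℝ k A x‖ ≤ B) (x y : E) : ‖A x - A y‖ ≤ B * ‖x - y‖ :=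
  convex_univ.norm_image_sub_le_of_norm_fderiv_le
    (fun z _ => hA.differentiable two_ne_zero z)
    (fun z _ => norm_fderiv_le_of_iteratedFDeriv hB z) (mem_univ y) (mem_univ x)

theorem lipschitz_fderiv_of_iteratedFDeriv (hA : ContDiff ℝ 2 A)
    (hB : ∀ k ≤ 2, ∀ x, ‖iteratedFDeriv ℝ k A x‖ ≤ B) (x y : E) :
    ‖fderiv ℝ A x - fderiv ℝ A y‖ ≤ B * ‖x - y‖ := by
  refine convex_univ.norm_image_sub_le_of_norm_fderiv_le (𝕜 := ℝ) (fun z _ => ?_) (fun z _ => ?_)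
    (mem_univ y) (mem_univ x)
  · exact (hA.fderiv_right (m := 1) (by norm_num)).differentiable one_ne_zero z
  · rw [← norm_iteratedFDeriv_one, norm_iteratedFDeriv_fderiv]
    exact hB 2 le_rfl z

end Combination

section Matrix

variable {N : ℕ}

/-- The bilinear form `(u, v) ↦ u i * v j`. -/
noncomputable def coordForm (p : Fin N × Fin N) :
    EuclideanSpace ℝ (Fin N) →L[ℝ] EuclideanSpace ℝ (Fin N) →L[ℝ] ℝ :=
  (EuclideanSpace.proj p.1 : EuclideanSpace ℝ (Fin N) →L[ℝ] ℝ).smulRight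
    (EuclideanSpace.proj p.2 : EuclideanSpace ℝ (Fin N) →L[ℝ] ℝ)

/-- The map sending a linear form `φ` to the vector `φ (e j) e i`. -/
noncomputable def coordDualMap (p : Fin N × Fin N) :
    (EuclideanSpace ℝ (Fin N) →L[ℝ] ℝ) →L[ℝ] EuclideanSpace ℝ (Fin N) :=
  (ContinuousLinearMap.apply ℝ ℝ (EuclideanSpace.single p.2 (1 : ℝ))).smulRight
    (EuclideanSpace.single p.1 (1 : ℝ))

/-- The field of bilinear forms with coefficients `g`. -/
noncomputable def matrixForm (g : EuclideanSpace ℝ (Fin N) → Matrix (Fin N) (Fin N) ℝ)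
    (x : EuclideanSpace ℝ (Fin N)) :
    EuclideanSpace ℝ (Fin N) →L[ℝ] EuclideanSpace ℝ (Fin N) →L[ℝ] ℝ :=
  ∑ p : Fin N × Fin N, g x p.1 p.2 • coordForm p

/-- The field of maps from linear forms to vectors with coefficients `k`. -/
noncomputable def matrixDualMap (k : EuclideanSpace ℝ (Fin N) → Matrix (Fin N) (Fin N) ℝ)
    (x : EuclideanSpace ℝ (Fin N)) :
    (EuclideanSpace ℝ (Fin N) →L[ℝ] ℝ) →L[ℝ] EuclideanSpace ℝ (Fin N) :=
  ∑ p : Fin N × Fin N, k x p.1 p.2 • coordDualMap p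

theorem matrixForm_apply (g : EuclideanSpace ℝ (Fin N) → Matrix (Fin N) (Fin N) ℝ)
    (x u v : EuclideanSpace ℝ (Fin N)) :
    matrixForm g x u v = ∑ i, ∑ j, g x i j * u i * v j := by
  rw [matrixForm, Fintype.sum_prod_type]
  simp [coordForm, mul_assoc]

theorem matrixDualMap_apply (k : EuclideanSpace ℝ (Fin N) → Matrix (Fin N) (Fin N) ℝ)
    (x : EuclideanSpace ℝ (Fin N)) (φ : EuclideanSpace ℝ (Fin N) →L[ℝ] ℝ) (i : Fin N) :
    matrixDualMap k x φ i = ∑ j, k x i j * φ (EuclideanSpace.single j 1) := by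
  rw [matrixDualMap, Fintype.sum_prod_type]
  simp [coordDualMap, Pi.single_apply]

/-- The inverse matrix field gives the inverse of the metric, viewed as a map to the dual space. -/
theorem matrixForm_matrixDualMap {g : EuclideanSpace ℝ (Fin N) → Matrix (Fin N) (Fin N) ℝ}
    (hg : ∀ x, (g x).PosDef) (x : EuclideanSpace ℝ (Fin N))
    (φ : EuclideanSpace ℝ (Fin N) →L[ℝ] ℝ) :
    matrixForm g x (matrixDualMap (fun x => (g x)⁻¹) x φ) = φ := by
  have hinv : g x * (g x)⁻¹ = 1 :=
    Matrix.mul_nonsing_inv _ (Matrix.isUnit_iff_isUnit_det _ |>.1 (hg x).isUnit)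
  have hsymm (i j : Fin N) : g x i j = g x j i := by
    simpa using congrFun (congrFun (hg x).isHermitian i) j |>.symm
  have hbasis (l : Fin N) : matrixForm g x (matrixDualMap (fun x => (g x)⁻¹) x φ)
      (EuclideanSpace.single l 1) = φ (EuclideanSpace.single l 1) := by
    have h1 : ∀ j, ∑ i, g x l i * (g x)⁻¹ i j = (1 : Matrix (Fin N) (Fin N) ℝ) l j := fun j => by
      rw [← hinv, Matrix.mul_apply]
    calc _ = ∑ i, g x l i * ∑ j, (g x)⁻¹ i j * φ (EuclideanSpace.single j 1) := by
          rw [matrixForm_apply]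
          simp [matrixDualMap_apply, hsymm l]
      _ = ∑ j, (∑ i, g x l i * (g x)⁻¹ i j) * φ (EuclideanSpace.single j 1) := by
          simp_rw [Finset.mul_sum, Finset.sum_mul, mul_assoc]
          exact Finset.sum_comm
      _ = _ := by simp [h1, Matrix.one_apply]
  refine ContinuousLinearMap.coe_injective
    ((EuclideanSpace.basisFun (Fin N) ℝ).toBasis.ext fun l => ?_)
  simpa using hbasis l

theorem contDiff_matrixForm {M : ℝ} {g : EuclideanSpace ℝ (Fin N) → Matrix (Fin N) (Fin N) ℝ}
    (hg : C2BoundedBy M g) : ContDiff ℝ 2 (matrixForm g) :=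
  contDiff_combination (f := fun (p : Fin N × Fin N) x => g x p.1 p.2)
    (fun p => (hg p.1 p.2).1) coordForm

theorem norm_iteratedFDeriv_matrixForm_le {M : ℝ}
    {g : EuclideanSpace ℝ (Fin N) → Matrix (Fin N) (Fin N) ℝ} (hg : C2BoundedBy M g) {k : ℕ}
    (hk : k ≤ 2) (x : EuclideanSpace ℝ (Fin N)) :
    ‖iteratedFDeriv ℝ k (matrixForm g) x‖ ≤ combinationConst (coordForm (N := N)) * M :=
  norm_iteratedFDeriv_combination_le (f := fun (p : Fin N × Fin N) x => g x p.1 p.2)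
    (fun p => (hg p.1 p.2).1) hk (fun p => (hg p.1 p.2).2 k hk x) coordForm

theorem contDiff_matrixDualMap {M : ℝ} {k : EuclideanSpace ℝ (Fin N) → Matrix (Fin N) (Fin N) ℝ}
    (hk : C2BoundedBy M k) : ContDiff ℝ 2 (matrixDualMap k) :=
  contDiff_combination (f := fun (p : Fin N × Fin N) x => k x p.1 p.2)
    (fun p => (hk p.1 p.2).1) coordDualMap

theorem norm_iteratedFDeriv_matrixDualMap_le {M : ℝ}
    {g : EuclideanSpace ℝ (Fin N) → Matrix (Fin N) (Fin N) ℝ} (hg : C2BoundedBy M g) {k : ℕ}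
    (hk : k ≤ 2) (x : EuclideanSpace ℝ (Fin N)) :
    ‖iteratedFDeriv ℝ k (matrixDualMap g) x‖ ≤ combinationConst (coordDualMap (N := N)) * M :=
  norm_iteratedFDeriv_combination_le (f := fun (p : Fin N × Fin N) x => g x p.1 p.2)
    (fun p => (hg p.1 p.2).1) hk (fun p => (hg p.1 p.2).2 k hk x) coordDualMap

/-- A `C²`-bounded field of positive definite matrices with `C²`-bounded inverse is a metric field,
with a constant depending only on the dimension and on the bound for the entries. -/
theorem isMetricField_matrixForm {M : ℝ}
    {g : EuclideanSpace ℝ (Fin N) → Matrix (Fin N) (Fin N) ℝ} (hpos : ∀ x, (g x).PosDef)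
    (hg : C2BoundedBy M g) (hinv : C2BoundedBy M fun x => (g x)⁻¹) :
    IsMetricField
      (max 1 (max (combinationConst (coordForm (N := N)) * M)
        (combinationConst (coordDualMap (N := N)) * M)))
      (matrixForm g) (matrixDualMap fun x => (g x)⁻¹) := by
  set C := max 1 (max (combinationConst (coordForm (N := N)) * M)
    (combinationConst (coordDualMap (N := N)) * M))
  have hG := contDiff_matrixForm hg
  have hH := contDiff_matrixDualMap hinv
  have hGB : ∀ k ≤ 2, ∀ x, ‖iteratedFDeriv ℝ k (matrixForm g) x‖ ≤ C := fun k hk x =>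
    (norm_iteratedFDeriv_matrixForm_le hg hk x).trans
      ((le_max_left _ _).trans (le_max_right _ _))
  have hHB : ∀ k ≤ 2, ∀ x, ‖iteratedFDeriv ℝ k (matrixDualMap fun x => (g x)⁻¹) x‖ ≤ C :=
    fun k hk x => (norm_iteratedFDeriv_matrixDualMap_le hinv hk x).trans
      ((le_max_right _ _).trans (le_max_right _ _))
  exact
    { one_le := le_max_left _ _
      contDiff := hG
      contDiff_inv := hH.of_le one_le_two
      symm := fun x u v => by
        rw [matrixForm_apply, matrixForm_apply, Finset.sum_comm]
        refine Finset.sum_congr rfl fun j _ => Finset.sum_congr rfl fun i _ => ?_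
        have : g x i j = g x j i := by
          simpa using congrFun (congrFun (hpos x).isHermitian i) j |>.symm
        rw [this]
        ring
      nonneg := fun x v => by
        have := (hpos x).posSemidef.dotProduct_mulVec_nonneg v
        rw [matrixForm_apply]
        refine this.trans_eq ?_
        simp only [dotProduct, Matrix.mulVec, Finset.mul_sum, Pi.star_apply, star_trivial]
        refine Finset.sum_congr rfl fun i _ => Finset.sum_congr rfl fun j _ => ?_
        ring
      apply_inv := matrixForm_matrixDualMap hpos
      norm_le := norm_le_of_iteratedFDeriv hGB
      norm_fderiv_le := norm_fderiv_le_of_iteratedFDeriv hGB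
      lipschitz_fderiv := lipschitz_fderiv_of_iteratedFDeriv hG hGB
      norm_inv_le := norm_le_of_iteratedFDeriv hHB
      lipschitz_inv := lipschitz_of_iteratedFDeriv hH hHB }

theorem metricDist_eq_riemannDist (g : EuclideanSpace ℝ (Fin N) → Matrix (Fin N) (Fin N) ℝ)
    (x y : EuclideanSpace ℝ (Fin N)) : metricDist g x y = riemannDist (matrixForm g) x y := by
  have : halfLength g = riemannHalfLength (matrixForm g) := by
    funext γ
    simp only [halfLength, riemannHalfLength, matrixForm_apply, curveVelocity]
  rw [metricDist, riemannDist, this]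

end Matrix

theorem mainTheorem4 (N : ℕ) (M : ℝ) :
    ∃ Υ : ℝ, 0 < Υ ∧ ∃ K : ℝ,
      ∀ g : EuclideanSpace ℝ (Fin N) → Matrix (Fin N) (Fin N) ℝ,
        (∀ x, (g x).PosDef) →
        C2BoundedBy M g →
        C2BoundedBy M (fun x => (g x)⁻¹) →
        IsOpen {z : EuclideanSpace ℝ (Fin N) × EuclideanSpace ℝ (Fin N) |
          metricDist g z.1 z.2 < Υ} ∧
        ContDiffOn ℝ 2 (metricEnergy g)
          {z : EuclideanSpace ℝ (Fin N) × EuclideanSpace ℝ (Fin N) |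
            metricDist g z.1 z.2 < Υ} ∧
        ∀ z : EuclideanSpace ℝ (Fin N) × EuclideanSpace ℝ (Fin N),
          metricDist g z.1 z.2 < Υ →
            ‖iteratedFDeriv ℝ 2 (metricEnergy g) z‖ ≤ K := by
  set C := max 1 (max (combinationConst (coordForm (N := N)) * M)
    (combinationConst (coordDualMap (N := N)) * M))
  have hC : 1 ≤ C := le_max_left _ _
  refine ⟨1 / (24 * (4 * C ^ 2)) / (2 * C), by positivity, 7 * C, fun g hpos hg hinv => ?_⟩
  have henergy : metricEnergy g = fun z => riemannDist (matrixForm g) z.1 z.2 ^ 2 := by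
    funext z
    rw [metricEnergy, metricDist_eq_riemannDist]
  simp only [henergy, metricDist_eq_riemannDist]
  exact (isMetricField_matrixForm hpos hg hinv).contDiffOn_riemannDist_sq
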